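/- Let $\nu$ be a dimension, let $\mu$ be a probability measure on $\mathbb R$, and let $\{V(n)\}_{n\in\mathbb Z^\nu}$ be independent real random variables on a probability space $(\Omega,\mathbb P)$, each with law $\mu$. For $\omega\in\Omega$ let $H^\omega=\Delta+V^\omega$ on $\ell^2(\mathbb Z^\nu)$ (the Anderson model), where $(\Delta u)(n)=\sum_{|i|=1}u(n+i)$ and $(V^\omega u)(n)=V(n)(\omega)\,u(n)$, with domain $\{u\in\ell^2(\mathbb Z^\nu): V^\omega u\in\ell^2(\mathbb Z^\nu)\}$. Then every $H^\omega$ is self-adjoint and hence has a unique projection-valued spectral measure $E_{H^\omega}$; the measure $\langle\delta_0,E_{H^\omega}(\cdot)\delta_0\rangle$ depends measurably on $\omega$, and the density of states $$\mathcal N(B)=\mathbb E\,\langle\delta_0,E_{H^\omega}(B)\,\delta_0\rangle,\qquad B\subseteq\mathbb R\ \text{Borel},$$ is a probability measure on $\mathbb R$. Call a probability measure $\sigma$ on $\mathbb R$ uniformly $\alpha$-Hölder continuous if $$\sup_{x\in\mathbb R}\ \sup_{0<\epsilon\le 1}\frac{\sigma((x-\epsilon,x+\epsilon))}{(2\epsilon)^\alpha}<\infty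 .$$ If $0<\alpha\le 1$ and $\mu$ is uniformly $\alpha$-Hölder continuous, then the density of states $\mathcal N$ is uniformly $\alpha$-Hölder continuous with the same exponent $\alpha$. -/

import Mathlib

open MeasureTheory ProbabilityTheory Set
open scoped ENNReal LinearPMap

/-- A measure `μ` on `ℝ` is uniformly `α`-Hölder continuous if
`sup_x sup_{0 < ε ≤ 1} μ((x - ε, x + ε)) / (2ε)^α < ∞`. -/
def UniformlyHolderContinuous (α : ℝ) (μ : Measure ℝ) : Prop :=
  (⨆ x : ℝ, ⨆ ε ∈ Set.Ioc (0 : ℝ) 1,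
    μ (Set.Ioo (x - ε) (x + ε)) / ENNReal.ofReal ((2 * ε) ^ α)) < ∞

/-- Projection-valued Borel measures on `ℝ`: every Borel set is sent to an orthogonal projection,
the whole line to the identity, intersections to products, and countable disjoint unions to sums
converging in the strong operator topology. Sets that are not Borel get the value `0`, so that
such a measure is determined by its values on Borel sets. -/
structure ProjectionValuedMeasure (E : Type*) [NormedAddCommGroup E] [InnerProductSpace ℂ E]
    [CompleteSpace E] where
  proj : Set ℝ → E →L[ℂ] E
  isStarProjection : ∀ B, MeasurableSet B → IsStarProjection (proj B)
  proj_univ : proj Set.univ = 1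
  proj_inter : ∀ A B, MeasurableSet A → MeasurableSet B → proj (A ∩ B) = proj A * proj B
  hasSum_iUnion : ∀ f : ℕ → Set ℝ, (∀ i, MeasurableSet (f i)) → Pairwise (Function.onFun Disjoint f) →
    ∀ u : E, HasSum (fun i => proj (f i) u) (proj (⋃ i, f i) u)
  not_measurable : ∀ B, ¬ MeasurableSet B → proj B = 0

namespace ProjectionValuedMeasure

variable {E : Type*} [NormedAddCommGroup E] [InnerProductSpace ℂ E] [CompleteSpace E]

theorem proj_empty_apply (P : ProjectionValuedMeasure E) (u : E) : P.proj ∅ u = 0 := by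
  have h := P.hasSum_iUnion (fun _ => ∅) (fun _ => MeasurableSet.empty)
    (fun i j _ => by simp [Function.onFun]) u
  have h2 := h.summable.tendsto_atTop_zero
  simpa using tendsto_nhds_unique tendsto_const_nhds h2

theorem re_inner_nonneg (P : ProjectionValuedMeasure E) {B : Set ℝ} (hB : MeasurableSet B) (u : E) :
    0 ≤ (inner ℂ u (P.proj B u)).re := by
  have h := P.isStarProjection B hB
  have h1 : P.proj B (P.proj B u) = P.proj B u := by
    have := congrArg (fun S : E →L[ℂ] E => S u) h.isIdempotentElem.eq
    simpa using this
  have h2 := h.isSelfAdjoint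
  rw [← h1, ← ContinuousLinearMap.adjoint_inner_left, ← ContinuousLinearMap.star_eq_adjoint,
    h2.star_eq]
  exact inner_self_nonneg (𝕜 := ℂ)

/-- The measure `B ↦ ⟨u, E(B) u⟩`. -/
noncomputable def measureAt (P : ProjectionValuedMeasure E) (u : E) : Measure ℝ :=
  Measure.ofMeasurable (fun B _ => ENNReal.ofReal (inner ℂ u (P.proj B u)).re)
    (by simp [P.proj_empty_apply u])
    (by
      intro f hf hd
      have h := P.hasSum_iUnion f hf hd u
      have h2 : HasSum (fun i => (inner ℂ u (P.proj (f i) u)).re)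
          (inner ℂ u (P.proj (⋃ i, f i) u)).re :=
        Complex.hasSum_re (h.mapL (innerSL ℂ u))
      rw [← h2.tsum_eq, ENNReal.ofReal_tsum_of_nonneg
        (fun i => P.re_inner_nonneg (hf i) u) h2.summable])

end ProjectionValuedMeasure

/-- `P` is the spectral measure of the (possibly unbounded) operator `T`, that is, `T = ∫ x dP(x)`:
the domain of `T` is `{u | ∫ x² d⟨u, P(x) u⟩ < ∞}` and `⟨u, T u⟩ = ∫ x d⟨u, P(x) u⟩` on it
(by polarization, this determines `T`). -/
structure IsSpectralMeasureOf {E : Type*} [NormedAddCommGroup E] [InnerProductSpace ℂ E]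
    [CompleteSpace E] (T : E →ₗ.[ℂ] E) (P : ProjectionValuedMeasure E) : Prop where
  mem_domain_iff : ∀ u : E, u ∈ T.domain ↔ Integrable (fun x : ℝ => x ^ 2) (P.measureAt u)
  inner_apply : ∀ u : T.domain,
    inner ℂ (u : E) (T u) = ((∫ x : ℝ, x ∂(P.measureAt (u : E)) : ℝ) : ℂ)

open Classical in
/-- The measure `⟨u, E_T(·) u⟩`, where `E_T` is the spectral measure of `T`
(and the zero measure for an operator that has no spectral measure). -/
noncomputable def spectralMeasureAt {E : Type*} [NormedAddCommGroup E] [InnerProductSpace ℂ E]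
    [CompleteSpace E] (T : E →ₗ.[ℂ] E) (u : E) : Measure ℝ :=
  if h : ∃ P : ProjectionValuedMeasure E, IsSpectralMeasureOf T P then h.choose.measureAt u else 0

/-- The Hilbert space `ℓ²(ℤ^d)`. -/
abbrev LatticeL2 (d : ℕ) : Type := lp (fun _ : Fin d → ℤ => ℂ) 2

theorem LatticeL2.memℓp_shift {d : ℕ} (u : LatticeL2 d) (a : Fin d → ℤ) :
    Memℓp (fun n : Fin d → ℤ => u (n + a)) 2 := by
  have h := lp.memℓp u
  rw [memℓp_gen_iff (by norm_num)] at h ⊢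
  exact h.comp_injective (add_left_injective a)

/-- The lattice Laplacian `(Δ u)(n) = ∑_{|i| = 1} u(n + i)` on `ℓ²(ℤ^d)`; the `i ∈ ℤ^d` with
`|i| = 1` are the `2d` vectors `± e_k`. -/
noncomputable def latticeLaplacian (d : ℕ) : LatticeL2 d →ₗ[ℂ] LatticeL2 d where
  toFun u := ⟨fun n => ∑ k : Fin d, (u (n + Pi.single k 1) + u (n + -Pi.single k 1)),
    Memℓp.finsetSum Finset.univ fun k _ =>
      (LatticeL2.memℓp_shift u (Pi.single k 1)).add (LatticeL2.memℓp_shift u (-Pi.single k 1))⟩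
  map_add' u v := by
    ext n
    simp only [lp.coeFn_add, Pi.add_apply, ← Finset.sum_add_distrib]
    exact Finset.sum_congr rfl fun k _ => by ring
  map_smul' c u := by
    ext n
    simp only [lp.coeFn_smul, Pi.smul_apply, smul_eq_mul, RingHom.id_apply, Finset.mul_sum, mul_add]

/-- Multiplication by a real function `w` on `ℤ^d`, with its maximal domain
`{u ∈ ℓ²(ℤ^d) | w u ∈ ℓ²(ℤ^d)}`. -/
noncomputable def latticePotential {d : ℕ} (w : (Fin d → ℤ) → ℝ) :
    LatticeL2 d →ₗ.[ℂ] LatticeL2 d where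
  domain :=
    { carrier := {u | Memℓp (fun n => (w n : ℂ) * u n) 2}
      zero_mem' := by
        have h : (fun n => (w n : ℂ) * (0 : LatticeL2 d) n) = 0 := by ext n; simp
        show Memℓp _ 2
        rw [h]; exact zero_memℓp
      add_mem' := by
        intro u v hu hv
        have h : (fun n => (w n : ℂ) * (u + v) n)
            = (fun n => (w n : ℂ) * u n) + fun n => (w n : ℂ) * v n := by
          ext n; simp [mul_add]
        show Memℓp _ 2
        rw [h]; exact Memℓp.add hu hv
      smul_mem' := by
        intro c u hu
        have h : (fun n => (w n : ℂ) * (c • u) n) = c • fun n => (w n : ℂ) * u n := by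
          ext n; simp [mul_left_comm]
        show Memℓp _ 2
        rw [h]; exact Memℓp.const_smul hu c }
  toFun :=
    { toFun := fun u => ⟨fun n => (w n : ℂ) * (u : LatticeL2 d) n, u.2⟩
      map_add' := by intro u v; ext n; simp [mul_add]; rfl
      map_smul' := by intro c u; ext n; simp [mul_left_comm] }

/-- The operator `Δ + w` on `ℓ²(ℤ^d)`, with domain `{u ∈ ℓ²(ℤ^d) | w u ∈ ℓ²(ℤ^d)}`. -/
noncomputable def andersonOperator {d : ℕ} (w : (Fin d → ℤ) → ℝ) :
    LatticeL2 d →ₗ.[ℂ] LatticeL2 d :=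
  latticeLaplacian d +ᵥ latticePotential w

/-- The unit vector `δ_n` of `ℓ²(ℤ^d)`. -/
noncomputable def latticeDelta {d : ℕ} (n : Fin d → ℤ) : LatticeL2 d := lp.single 2 n 1

/-- The density of states `B ↦ 𝔼 ⟨δ_0, E_{H^ω}(B) δ_0⟩` of the operators `H^ω = Δ + V^ω`, where
`V^ω` is multiplication by `n ↦ V n ω`. -/
noncomputable def densityOfStates {d : ℕ} {Ω : Type*} [MeasurableSpace Ω] (Pr : Measure Ω)
    (V : (Fin d → ℤ) → Ω → ℝ) : Measure ℝ :=
  Pr.bind fun ω => spectralMeasureAt (andersonOperator fun n => V n ω) (latticeDelta 0)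

/-! The Hölder bound is spectral averaging over the potential at the origin. Put `z = x + iε` and
let `G` be the diagonal resolvent entry at the origin. Since `2ε Im 1/(t - z)` is at least `1` for
`|t - x| < ε`, the spectral measure of `(x - ε, x + ε)` is at most `2ε Im G`
(`spectralMeasureAt_Ioo_le`). With all other sites frozen, the value `v = V(0)` enters as a rank-one
perturbation: if `g` is the entry for `v = 0`, then `G (1 + v g) = g` (`greenFunction_mul_one_add`),
so `G = 1/(v + 1/g)` unless `g = 0`, in which case `G = 0`. As a function of `v`, `Im G` is thus at
most a Poisson kernel of some centre `a` and width `y`, and `Im g ≥ ε|g|²` forces `y ≥ ε`.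
Independence allows integrating over `v` first. A dyadic decomposition gives `∫ y²/((v - a)² + y²)
dμ(v) ≤ C y^α`, and `ε y^(α-1) ≤ ε^α` because `α ≤ 1` and `ε ≤ y`. The bound does not depend on `x`
or on the frozen sites.

Most of the work is well-definedness. For self-adjoint `T` the resolvent `R = (T + i)⁻¹` is normal;
its continuous functional calculus and the Riesz–Markov theorem give projections for Borel subsets
of the spectrum of `R`, carried to the line by `x ↦ Re(1/x)`. Conversely, every spectral measure of
`T` reproduces the resolvent as `∫ (x - z)⁻¹ dP` (`IsSpectralMeasureOf.isResolventAt`). Two spectral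
measures therefore agree on polynomials in `R` and its adjoint, and Stone–Weierstrass on the closed
unit disc gives uniqueness. For measurability, the resolvent is strongly continuous in the
potential, so the spectral measures of `δ_0`, moved to the disc, are weakly continuous in the
potential. -/

open Filter Topology

/-! ### Bounded operators and their quadratic forms -/

namespace ContinuousLinearMap

variable {E : Type*} [NormedAddCommGroup E] [InnerProductSpace ℂ E]

theorem inner_polarization (T : E →L[ℂ] E) (v u : E) :
    inner ℂ v (T u) = (inner ℂ (v + u) (T (v + u)) - inner ℂ (v - u) (T (v - u))
      - Complex.I * inner ℂ (v + Complex.I • u) (T (v + Complex.I • u))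
      + Complex.I * inner ℂ (v - Complex.I • u) (T (v - Complex.I • u))) / 4 := by
  simp only [map_add, map_sub, map_smul, inner_add_left, inner_add_right, inner_sub_left,
    inner_sub_right, inner_smul_left, inner_smul_right, Complex.conj_I]
  linear_combination ((inner ℂ v (T u)) / 2 - (inner ℂ u (T v)) / 2) * Complex.I_sq

/-- By polarization over `ℂ`, diagonal values control all matrix elements; later arguments therefore
only track the scalar measures `⟨u, · u⟩`. -/
theorem tendsto_inner_of_tendsto_quadratic {ι : Type*} {l : Filter ι} {T : ι → E →L[ℂ] E}
    {S : E →L[ℂ] E}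
    (h : ∀ u, Tendsto (fun i => inner ℂ u (T i u)) l (𝓝 (inner ℂ u (S u)))) (v u : E) :
    Tendsto (fun i => inner ℂ v (T i u)) l (𝓝 (inner ℂ v (S u))) := by
  simp_rw [fun i => inner_polarization (T i) v u, inner_polarization S v u]
  exact ((((h _).sub (h _)).sub ((h _).const_mul _)).add ((h _).const_mul _)).div_const _

theorem ext_quadratic {T S : E →L[ℂ] E} (h : ∀ u, inner ℂ u (T u) = inner ℂ u (S u)) : T = S := by
  refine ContinuousLinearMap.ext fun u => ext_inner_left ℂ fun v => ?_
  rw [inner_polarization, inner_polarization S]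
  simp only [h]

/-- A bound on the quadratic form of an operator bounds its operator norm. -/
theorem norm_apply_le_of_quadratic_le {T : E →L[ℂ] E} {C : ℝ} (hC : 0 ≤ C)
    (h : ∀ u, ‖inner ℂ u (T u)‖ ≤ C * ‖u‖ ^ 2) (u : E) : ‖T u‖ ≤ 2 * C * ‖u‖ := by
  have key : ∀ v u : E, ‖inner ℂ v (T u)‖ ≤ C * (‖v‖ ^ 2 + ‖u‖ ^ 2) := by
    intro v u
    have hI : ‖Complex.I • u‖ = ‖u‖ := by simp [norm_smul]
    have p1 := parallelogram_law_with_norm ℂ v u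
    have p2 := parallelogram_law_with_norm ℂ v (Complex.I • u)
    rw [hI] at p2
    rw [inner_polarization, norm_div]
    have h1 := h (v + u)
    have h2 := h (v - u)
    have h3 := h (v + Complex.I • u)
    have h4 := h (v - Complex.I • u)
    have n4 : ‖(4 : ℂ)‖ = 4 := by simp
    rw [n4, div_le_iff₀ (by norm_num)]
    refine (norm_add_le _ _).trans ?_
    refine (add_le_add_left ((norm_sub_le _ _).trans (add_le_add_left (norm_sub_le _ _) _)) _).trans ?_
    simp only [norm_mul, Complex.norm_I, one_mul]
    have p3 : C * (‖v + u‖ ^ 2 + ‖v - u‖ ^ 2) = C * (2 * (‖v‖ ^ 2 + ‖u‖ ^ 2)) := by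
      linear_combination C * p1
    have p4 : C * (‖v + Complex.I • u‖ ^ 2 + ‖v - Complex.I • u‖ ^ 2)
        = C * (2 * (‖v‖ ^ 2 + ‖u‖ ^ 2)) := by
      linear_combination C * p2
    linarith
  rcases eq_or_ne (T u) 0 with h0 | h0
  · rw [h0, norm_zero]; positivity
  rcases eq_or_ne u 0 with hu | hu
  · simp [hu]
  have hT : 0 < ‖T u‖ := norm_pos_iff.2 h0
  have hu' : 0 < ‖u‖ := norm_pos_iff.2 hu
  -- The test vector is `T u` rescaled to the norm of `u`, which balances the two squares in `key`.
  have := key (((‖u‖ / ‖T u‖ : ℝ) : ℂ) • T u) u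
  rw [inner_smul_left, norm_mul, norm_smul, inner_self_eq_norm_sq_to_K] at this
  simp only [Complex.conj_ofReal, Complex.norm_real, norm_div, norm_norm, norm_pow,
    Complex.coe_algebraMap] at this
  have e1 : ‖u‖ / ‖T u‖ * ‖T u‖ ^ 2 = ‖u‖ * ‖T u‖ := by field_simp
  have e2 : ‖u‖ / ‖T u‖ * ‖T u‖ = ‖u‖ := by field_simp
  rw [e1, e2] at this
  have : ‖u‖ * ‖T u‖ ≤ ‖u‖ * (2 * C * ‖u‖) := by linarith
  exact le_of_mul_le_mul_left this hu'

/-- A sequence of operators whose quadratic forms converge to a bounded form converges weakly. -/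
theorem exists_weak_limit [CompleteSpace E] {T : ℕ → E →L[ℂ] E} {q : E → ℂ} {C : ℝ}
    (hC : 0 ≤ C) (hb : ∀ n u, ‖inner ℂ u (T n u)‖ ≤ C * ‖u‖ ^ 2)
    (h : ∀ u, Tendsto (fun n => inner ℂ u (T n u)) atTop (𝓝 (q u))) :
    ∃ S : E →L[ℂ] E, ∀ u, inner ℂ u (S u) = q u := by
  have hL : ∀ v u, ∃ L : ℂ, Tendsto (fun n => inner ℂ (T n u) v) atTop (𝓝 L) := by
    intro v u
    have h1 : ∃ L : ℂ, Tendsto (fun n => inner ℂ v (T n u)) atTop (𝓝 L) := by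
      simp_rw [fun i => inner_polarization (T i) v u]
      exact ⟨_, ((((h _).sub (h _)).sub ((h _).const_mul _)).add ((h _).const_mul _)).div_const _⟩
    obtain ⟨L, hL⟩ := h1
    refine ⟨(starRingEnd ℂ) L, ?_⟩
    simpa [Function.comp_def, inner_conj_symm] using (Complex.continuous_conj.tendsto L).comp hL
  choose L hL using hL
  have hbd : ∀ v u, ‖L v u‖ ≤ 2 * C * ‖u‖ * ‖v‖ := fun v u =>
    le_of_tendsto (hL v u).norm (Eventually.of_forall fun n =>
      (norm_inner_le_norm _ _).trans (by
        gcongr; exact norm_apply_le_of_quadratic_le hC (hb n) u))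
  -- The limits form a bounded sesquilinear form, and Riesz representation turns it into an
  -- operator.
  let φ : E → (E →L[ℂ] ℂ) := fun u => LinearMap.mkContinuous
    { toFun := fun v => L v u
      map_add' := fun v w => tendsto_nhds_unique (hL _ u) (by
        simpa only [inner_add_right] using (hL v u).add (hL w u))
      map_smul' := fun c v => tendsto_nhds_unique (hL _ u) (by
        simpa only [inner_smul_right, RingHom.id_apply, smul_eq_mul] using (hL v u).const_mul c) } (2 * C * ‖u‖) (fun v => hbd v u)
  let S : E → E := fun u => (InnerProductSpace.toDual ℂ E).symm (φ u)
  have hS : ∀ u v, inner ℂ (S u) v = L v u := fun u v => by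
    simp [S, InnerProductSpace.toDual_symm_apply, φ]
  let S' : E →L[ℂ] E := LinearMap.mkContinuous
    { toFun := S
      map_add' := fun u w => ext_inner_right ℂ fun v => by
        rw [inner_add_left, hS, hS, hS]
        refine tendsto_nhds_unique (hL v _) ?_
        simpa only [map_add, inner_add_left] using (hL v u).add (hL v w)
      map_smul' := fun c u => ext_inner_right ℂ fun v => by
        rw [RingHom.id_apply, inner_smul_left, hS, hS]
        refine tendsto_nhds_unique (hL v _) ?_
        simpa only [map_smul, inner_smul_left] using (hL v u).const_mul _ } (2 * C) (fun u => by
      refine ((InnerProductSpace.toDual ℂ E).symm.norm_map (φ u)).trans_le ?_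
      exact LinearMap.mkContinuous_norm_le _ (by positivity) _)
  refine ⟨S', fun u => ?_⟩
  have h1 : inner ℂ (S' u) u = L u u := hS u u
  rw [← inner_conj_symm, h1]
  refine tendsto_nhds_unique ?_ (h u)
  simpa [Function.comp_def, inner_conj_symm] using
    (Complex.continuous_conj.tendsto _).comp (hL u u)

end ContinuousLinearMap

/-! ### Borel functional calculus for representations of `C(X)` -/

section StarHom

variable {E : Type*} [NormedAddCommGroup E] [InnerProductSpace ℂ E] [CompleteSpace E]
variable {X : Type*} [TopologicalSpace X] [CompactSpace X] [T2Space X] [MeasurableSpace X]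
  [BorelSpace X]

theorem ContinuousLinearMap.inner_star_mul_self_apply (A : E →L[ℂ] E) (u : E) :
    inner ℂ u ((star A * A) u) = ((‖A u‖ ^ 2 : ℝ) : ℂ) := by
  rw [ContinuousLinearMap.star_eq_adjoint, mul_apply_eq_comp,
    ContinuousLinearMap.adjoint_inner_right, inner_self_eq_norm_sq_to_K]
  simp

/-- The quadratic form of a representation of `C(X)` is given by integration. -/
theorem StarAlgHom.exists_measure_inner_eq_integral (π : C(X, ℂ) →⋆ₐ[ℂ] (E →L[ℂ] E)) (u : E) :
    ∃ ν : Measure X, IsFiniteMeasure ν ∧ ∀ g : C(X, ℂ), inner ℂ u (π g u) = ∫ x, g x ∂ν := by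
  let c : C(X, ℝ) → C(X, ℂ) := fun f => ⟨fun x => (f x : ℂ), by fun_prop⟩
  have hpos : ∀ f : C(X, ℝ), 0 ≤ f → 0 ≤ (inner ℂ u (π (c f) u)).re := by
    intro f hf
    -- Positivity of the functional: `f` is the square of `√f`, so its value at `u` is a squared
    -- norm.
    have : c f = star (c ⟨fun x => √(f x), by fun_prop⟩) * c ⟨fun x => √(f x), by fun_prop⟩ := by
      ext x
      simp [c, ← Complex.ofReal_mul]
      exact (Real.mul_self_sqrt (hf x)).symm
    rw [this, map_mul, map_star, ContinuousLinearMap.inner_star_mul_self_apply, Complex.ofReal_re]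
    positivity
  have hreal : ∀ f : C(X, ℝ), (inner ℂ u (π (c f) u)).im = 0 := by
    intro f
    have h1 : star (π (c f)) = π (c f) := by
      rw [← map_star]; congr 1; ext x; simp [c]
    rw [← Complex.conj_eq_iff_im, inner_conj_symm, ← ContinuousLinearMap.adjoint_inner_right,
      ← ContinuousLinearMap.star_eq_adjoint, h1]
  have hadd : ∀ f g : C(X, ℝ), c (f + g) = c f + c g := fun f g => by ext x; simp [c]
  have hsmul : ∀ (a : ℝ) (f : C(X, ℝ)), c (a • f) = (a : ℂ) • c f := fun a f => by
    ext x; simp [c]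
  let Λ : CompactlySupportedContinuousMap X ℝ →ₚ[ℝ] ℝ :=
    { toFun := fun f => (inner ℂ u (π (c f.toContinuousMap) u)).re
      map_add' := fun f g => by
        have : (f + g).toContinuousMap = f.toContinuousMap + g.toContinuousMap := rfl
        rw [this, hadd]; simp
      map_smul' := fun a f => by
        have : (a • f).toContinuousMap = a • f.toContinuousMap := rfl
        rw [this, hsmul, map_smul, _root_.smul_apply, inner_smul_right]; simp
      monotone' := fun f g hfg => by
        have h := hpos (g.toContinuousMap - f.toContinuousMap) (by
          intro x; simpa using hfg x)
        have e : c g.toContinuousMap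
            = c (g.toContinuousMap - f.toContinuousMap) + c f.toContinuousMap := by
          rw [← hadd]; simp
        simp only [e, map_add, _root_.add_apply, inner_add_right, Complex.add_re]
        linarith }
  have hΛ : ∀ f : C(X, ℝ), inner ℂ u (π (c f) u) = ((∫ x, f x ∂(RealRMK.rieszMeasure Λ) : ℝ) : ℂ) := by
    intro f
    let f' : CompactlySupportedContinuousMap X ℝ :=
      { toContinuousMap := f, hasCompactSupport' := HasCompactSupport.of_compactSpace _ }
    have h := RealRMK.integral_rieszMeasure Λ f'
    apply Complex.ext
    · rw [Complex.ofReal_re]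
      exact h.symm
    · rw [hreal, Complex.ofReal_im]
  refine ⟨RealRMK.rieszMeasure Λ, inferInstance, fun g => ?_⟩
  let gr : C(X, ℝ) := ⟨fun x => (g x).re, by fun_prop⟩
  let gi : C(X, ℝ) := ⟨fun x => (g x).im, by fun_prop⟩
  have hg : g = c gr + Complex.I • c gi := by
    ext x
    simp only [ContinuousMap.add_apply, ContinuousMap.smul_apply, smul_eq_mul]
    change g x = ((g x).re : ℂ) + Complex.I * ((g x).im : ℂ)
    rw [mul_comm]; exact (Complex.re_add_im _).symm
  have hint : Integrable (fun x => g x) (RealRMK.rieszMeasure Λ) :=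
    (BoundedContinuousFunction.mkOfCompact g).integrable _
  conv_lhs => rw [hg]
  simp only [map_add, map_smul, _root_.add_apply, _root_.smul_apply,
    inner_add_right, inner_smul_right, hΛ]
  rw [← integral_re_add_im hint, mul_comm]
  rfl

/-- A representation of `C(X)` extends to indicator functions of Borel sets. -/
theorem StarAlgHom.exists_spectral_family [HasOuterApproxClosed X]
    (π : C(X, ℂ) →⋆ₐ[ℂ] (E →L[ℂ] E)) :
    ∃ (ν : E → Measure X) (T : Set X → E →L[ℂ] E), (∀ u, IsFiniteMeasure (ν u)) ∧
      (∀ (g : C(X, ℂ)) u, inner ℂ u (π g u) = ∫ x, g x ∂(ν u)) ∧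
      (∀ B, MeasurableSet B → ∀ (g : C(X, ℂ)) u, inner ℂ u (T B (π g u)) = ∫ x in B, g x ∂(ν u)) ∧
      (∀ A, MeasurableSet A → ∀ B, MeasurableSet B → ∀ u,
        inner ℂ u (T A (T B u)) = ((ν u).real (A ∩ B) : ℂ)) := by
  choose ν hfin hν using fun u => π.exists_measure_inner_eq_integral u
  have hint : ∀ (g : C(X, ℂ)) u, Integrable (fun x => g x) (ν u) := fun g u =>
    (BoundedContinuousFunction.mkOfCompact g).integrable _
  have hmass : ∀ u, (ν u).real univ = ‖u‖ ^ 2 := fun u => by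
    have h := hν u 1
    rw [map_one, one_apply_eq_self, inner_self_eq_norm_sq_to_K] at h
    simp only [ContinuousMap.one_apply, integral_const, Complex.real_smul, mul_one] at h
    exact Complex.ofReal_injective (by simpa using h.symm)
  -- Continuous functions bounded by `1` that converge pointwise to the indicator of the closed set.
  let a : ∀ {F : Set X}, IsClosed F → ℕ → C(X, ℂ) := fun hF n =>
    ⟨fun x => ((hF.apprSeq n x : ℝ) : ℂ), by fun_prop⟩
  have ha_le : ∀ {F : Set X} (hF : IsClosed F) n x, ‖a hF n x‖ ≤ 1 := fun hF n x => by
    have := HasOuterApproxClosed.apprSeq_apply_le_one hF n x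
    simpa [a] using this
  have ha_lim : ∀ {F : Set X} (hF : IsClosed F) x,
      Tendsto (fun n => a hF n x) atTop (𝓝 (F.indicator (fun _ => 1) x)) := fun {F} hF x => by
    have h := tendsto_pi_nhds.1 (HasOuterApproxClosed.tendsto_apprSeq hF) x
    have h2 := ((Complex.continuous_ofReal.comp NNReal.continuous_coe).tendsto _).comp h
    have e : F.indicator (fun _ => (1 : ℂ)) x
        = (Complex.ofReal ∘ NNReal.toReal) (F.indicator (fun _ => 1) x) := by
      by_cases hx : x ∈ F <;> simp [hx]
    rw [e]
    exact h2
  have hborel : ‹MeasurableSpace X› = MeasurableSpace.generateFrom {s : Set X | IsClosed s} := by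
    rw [BorelSpace.measurable_eq (α := X), borel_eq_generateFrom_isClosed]
  have ha_int : ∀ {F : Set X} (hF : IsClosed F) (g : C(X, ℂ)) (u : E) (B : Set X),
      MeasurableSet B →
      Tendsto (fun n => ∫ x in B, (a hF n * g) x ∂(ν u)) atTop (𝓝 (∫ x in F ∩ B, g x ∂(ν u))) := by
    intro F hF g u B hB
    rw [← Measure.restrict_restrict hF.measurableSet, ← integral_indicator hF.measurableSet]
    refine tendsto_integral_of_dominated_convergence (fun x => ‖g x‖)
      (fun n => (ContinuousMap.continuous _).aestronglyMeasurable)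
      (hint g u).norm.restrict (fun n => ae_of_all _ fun x => ?_) (ae_of_all _ fun x => ?_)
    · rw [ContinuousMap.mul_apply, norm_mul]
      exact mul_le_of_le_one_left (norm_nonneg _) (ha_le hF n x)
    · have h := (ha_lim hF x).mul_const (g x)
      simp only [ContinuousMap.mul_apply]
      convert h using 2
      by_cases hx : x ∈ F <;> simp [hx]
  have hle : ∀ u B, (ν u).real B ≤ ‖u‖ ^ 2 := fun u B =>
    (measureReal_mono (subset_univ B)).trans_eq (hmass u)
  -- Carrying the factor `π g` through the induction records how `T B` interacts with the
  -- representation; `g = 1` alone would determine `T B` but not yield products. Closed sets and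
  -- disjoint unions are handled by weak limits.
  have hex : ∀ B, MeasurableSet B → ∃ T : E →L[ℂ] E, ∀ (g : C(X, ℂ)) u,
      inner ℂ u (T (π g u)) = ∫ x in B, g x ∂(ν u) := by
    intro B hB
    induction B, hB using MeasurableSpace.induction_on_inter hborel
      isPiSystem_isClosed with
    | empty => exact ⟨0, fun g u => by simp⟩
    | basic F hF =>
      replace hF : IsClosed F := hF
      have hq : ∀ u, Tendsto (fun n => inner ℂ u (π (a hF n) u)) atTop
          (𝓝 ((ν u).real F : ℂ)) := fun u => by
        have h := ha_int hF 1 u univ MeasurableSet.univ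
        simpa [hν] using h
      obtain ⟨T, hT⟩ := ContinuousLinearMap.exists_weak_limit (T := fun n => π (a hF n))
        zero_le_one (fun n u => by
          rw [hν, one_mul, ← hmass u]
          refine (norm_integral_le_of_norm_le_const (C := 1) (ae_of_all _ (ha_le hF n))).trans ?_
          simp) hq
      refine ⟨T, fun g u => ?_⟩
      have h1 := ContinuousLinearMap.tendsto_inner_of_tendsto_quadratic
        (T := fun n => π (a hF n)) (S := T) (by simpa only [hT] using hq) u (π g u)
      refine tendsto_nhds_unique h1 ?_
      have h2 := ha_int hF g u univ MeasurableSet.univ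
      simp only [Measure.restrict_univ, inter_univ, ← hν, map_mul] at h2
      exact h2
    | compl B hB ih =>
      obtain ⟨T, hT⟩ := ih
      refine ⟨1 - T, fun g u => ?_⟩
      rw [_root_.sub_apply, inner_sub_right, hT, setIntegral_compl hB (hint g u), ← hν]
      rfl
    | iUnion f hd hf ih =>
      choose T hT using ih
      have hsum : ∀ g u, Tendsto (fun n => inner ℂ u ((∑ i ∈ Finset.range n, T i) (π g u))) atTop
          (𝓝 (∫ x in ⋃ i, f i, g x ∂(ν u))) := fun g u => by
        have h := (hasSum_integral_iUnion hf hd (hint g u).integrableOn).tendsto_sum_nat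
        simpa [_root_.sum_apply, inner_sum, hT] using h
      have hT1 : ∀ i u, inner ℂ u (T i u) = ((ν u).real (f i) : ℂ) := fun i u => by
        simpa using hT i 1 u
      obtain ⟨S, hS⟩ := ContinuousLinearMap.exists_weak_limit
        (T := fun n => ∑ i ∈ Finset.range n, T i) zero_le_one (fun n u => by
          simp only [_root_.sum_apply, inner_sum, hT1]
          rw [← Complex.ofReal_sum, Complex.norm_real, one_mul, Real.norm_eq_abs,
            abs_of_nonneg (by positivity), ← measureReal_biUnion_finset
              (fun i _ j _ h => hd h) (fun i _ => hf i)]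
          exact hle u _) (fun u => by simpa using hsum 1 u)
      refine ⟨S, fun g u => ?_⟩
      have h1 := ContinuousLinearMap.tendsto_inner_of_tendsto_quadratic
        (T := fun n => ∑ i ∈ Finset.range n, T i) (S := S)
        (fun u => by simpa [hS] using hsum 1 u) u (π g u)
      exact tendsto_nhds_unique h1 (hsum g u)
  choose! T hT using hex
  have hT1 : ∀ B, MeasurableSet B → ∀ u, inner ℂ u (T B u) = ((ν u).real B : ℂ) :=
    fun B hB u => by simpa using hT B hB 1 u
  have hsa : ∀ B, MeasurableSet B → ∀ u v, inner ℂ (T B u) v = inner ℂ u (T B v) := by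
    intro B hB u v
    rw [← ContinuousLinearMap.adjoint_inner_right]
    congr 2
    refine ContinuousLinearMap.ext_quadratic fun w => ?_
    rw [ContinuousLinearMap.adjoint_inner_right, ← inner_conj_symm, hT1 B hB, Complex.conj_ofReal]
  have hcomm : ∀ B, MeasurableSet B → ∀ (g : C(X, ℂ)) u,
      inner ℂ u (π g (T B u)) = ∫ x in B, g x ∂(ν u) := by
    intro B hB g u
    rw [← ContinuousLinearMap.adjoint_inner_left, ← ContinuousLinearMap.star_eq_adjoint, ← map_star,
      ← inner_conj_symm, hsa B hB, hT B hB, ← integral_conj]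
    simp
  -- Multiplicativity is a second induction, over `A` with `B` fixed. For closed `A` one passes to
  -- the limit in `⟨u, π(aₙ) T_B u⟩ = ∫_B aₙ dν_u`, which is `hcomm`.
  refine ⟨ν, T, hfin, fun g u => hν u g, hT, fun A hA B hB u => ?_⟩
  induction A, hA using MeasurableSpace.induction_on_inter hborel
    isPiSystem_isClosed with
  | empty =>
    have : T ∅ = 0 := ContinuousLinearMap.ext_quadratic fun w => by
      simp [hT1 ∅ MeasurableSet.empty]
    simp [this]
  | basic F hF =>
    replace hF : IsClosed F := hF
    have h1 := ContinuousLinearMap.tendsto_inner_of_tendsto_quadratic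
      (T := fun n => π (a hF n)) (S := T F) (l := atTop) (fun u => by
        have h := ha_int hF 1 u univ MeasurableSet.univ
        simpa [hν, hT1 F hF.measurableSet] using h) u (T B u)
    refine tendsto_nhds_unique h1 ?_
    simpa [hcomm B hB] using ha_int hF 1 u B hB
  | compl A hA ih =>
    have : T Aᶜ = 1 - T A := ContinuousLinearMap.ext_quadratic fun w => by
      rw [_root_.sub_apply, inner_sub_right, hT1 _ hA, hT1 _ hA.compl,
        measureReal_compl hA, hmass]
      simp
    rw [this, _root_.sub_apply, inner_sub_right, ih]
    have h := measureReal_inter_add_sdiff (μ := ν u) (s := B) hA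
    rw [sdiff_eq, inter_comm B A, inter_comm B Aᶜ] at h
    rw [one_apply_eq_self, hT1 B hB, ← h]
    simp
  | iUnion f hd hf ih =>
    have hsum : ∀ (B : Set X) u, MeasurableSet B →
        HasSum (fun i => ((ν u).real (f i ∩ B) : ℂ)) ((ν u).real ((⋃ i, f i) ∩ B) : ℂ) := by
      intro B u hB
      have h := hasSum_integral_iUnion hf hd
        ((hint 1 u).restrict (s := B)).integrableOn
      simpa [Measure.restrict_restrict, hf, MeasurableSet.iUnion hf] using h
    have h1 := ContinuousLinearMap.tendsto_inner_of_tendsto_quadratic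
      (T := fun n => ∑ i ∈ Finset.range n, T (f i)) (S := T (⋃ i, f i)) (l := atTop) (fun u => by
        have h := (hsum univ u MeasurableSet.univ).tendsto_sum_nat
        simpa [_root_.sum_apply, inner_sum, hT1, hf, MeasurableSet.iUnion hf] using h)
      u (T B u)
    refine tendsto_nhds_unique h1 ?_
    simpa [_root_.sum_apply, inner_sum, ih] using (hsum B u hB).tendsto_sum_nat

end StarHom

/-! ### Projection-valued measures and their scalar measures -/

namespace ProjectionValuedMeasure

variable {E : Type*} [NormedAddCommGroup E] [InnerProductSpace ℂ E] [CompleteSpace E]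

theorem inner_proj_left (P : ProjectionValuedMeasure E) {B : Set ℝ} (hB : MeasurableSet B)
    (u v : E) : inner ℂ (P.proj B u) v = inner ℂ u (P.proj B v) := by
  rw [← ContinuousLinearMap.adjoint_inner_right, ← ContinuousLinearMap.star_eq_adjoint,
    (P.isStarProjection B hB).isSelfAdjoint.star_eq]

theorem proj_proj_apply (P : ProjectionValuedMeasure E) {A B : Set ℝ} (hA : MeasurableSet A)
    (hB : MeasurableSet B) (u : E) : P.proj A (P.proj B u) = P.proj (A ∩ B) u := by
  rw [P.proj_inter A B hA hB, mul_apply_eq_comp]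

theorem inner_proj (P : ProjectionValuedMeasure E) {B : Set ℝ} (hB : MeasurableSet B) (u : E) :
    inner ℂ u (P.proj B u) = ((P.measureAt u).real B : ℂ) := by
  have h : (inner ℂ u (P.proj B u)).im = 0 := by
    rw [← Complex.conj_eq_iff_im, inner_conj_symm, P.inner_proj_left hB]
  apply Complex.ext
  · rw [Complex.ofReal_re, Measure.real, measureAt, Measure.ofMeasurable_apply B hB,
      ENNReal.toReal_ofReal (P.re_inner_nonneg hB u)]
  · rw [h, Complex.ofReal_im]

theorem measureAt_univ (P : ProjectionValuedMeasure E) (u : E) :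
    P.measureAt u univ = ENNReal.ofReal (‖u‖ ^ 2) := by
  rw [measureAt, Measure.ofMeasurable_apply _ MeasurableSet.univ, P.proj_univ,
    one_apply_eq_self, inner_self_eq_norm_sq_to_K]
  norm_cast

instance (P : ProjectionValuedMeasure E) (u : E) : IsFiniteMeasure (P.measureAt u) :=
  ⟨by rw [P.measureAt_univ]; exact ENNReal.ofReal_lt_top⟩

theorem measureAt_real_univ (P : ProjectionValuedMeasure E) (u : E) :
    (P.measureAt u).real univ = ‖u‖ ^ 2 := by
  rw [Measure.real, P.measureAt_univ, ENNReal.toReal_ofReal (by positivity)]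

theorem ext_of_measureAt {P Q : ProjectionValuedMeasure E}
    (h : ∀ u, P.measureAt u = Q.measureAt u) : P = Q := by
  have : P.proj = Q.proj := by
    funext B
    by_cases hB : MeasurableSet B
    · exact ContinuousLinearMap.ext_quadratic fun u => by
        rw [P.inner_proj hB, Q.inner_proj hB, h]
    · rw [P.not_measurable B hB, Q.not_measurable B hB]
  cases P; cases Q; congr

/-- A multiplicative family of operators represented by finite measures on `X`, together with a
measurable function `φ : X → ℝ`, gives a projection-valued measure on `ℝ`. -/
theorem exists_of_spectral_family {X : Type*} [MeasurableSpace X] (ν : E → Measure X)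
    [∀ u, IsFiniteMeasure (ν u)] (T : Set X → E →L[ℂ] E)
    (hmass : ∀ u, (ν u).real univ = ‖u‖ ^ 2)
    (hT : ∀ B, MeasurableSet B → ∀ u, inner ℂ u (T B u) = ((ν u).real B : ℂ))
    (hmul : ∀ A, MeasurableSet A → ∀ B, MeasurableSet B → ∀ u,
        inner ℂ u (T A (T B u)) = ((ν u).real (A ∩ B) : ℂ))
    {φ : X → ℝ} (hφ : Measurable φ) :
    ∃ P : ProjectionValuedMeasure E, ∀ u, P.measureAt u = (ν u).map φ := by
  classical
  have hsa : ∀ B, MeasurableSet B → ∀ u v, inner ℂ (T B u) v = inner ℂ u (T B v) := by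
    intro B hB u v
    rw [← ContinuousLinearMap.adjoint_inner_right]
    congr 2
    refine ContinuousLinearMap.ext_quadratic fun w => ?_
    rw [ContinuousLinearMap.adjoint_inner_right, ← inner_conj_symm, hT B hB, Complex.conj_ofReal]
  have hmul' : ∀ A, MeasurableSet A → ∀ B, MeasurableSet B → T (A ∩ B) = T A * T B :=
    fun A hA B hB => ContinuousLinearMap.ext_quadratic fun u => by
      rw [mul_apply_eq_comp, hmul A hA B hB, hT _ (hA.inter hB)]
  have hnorm : ∀ B, MeasurableSet B → ∀ u, ‖T B u‖ ^ 2 = (ν u).real B := fun B hB u => by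
    have h := hmul B hB B hB u
    rw [← hsa B hB, inter_self, inner_self_eq_norm_sq_to_K] at h
    exact Complex.ofReal_injective (by simpa using h)
  have hunion : ∀ g : ℕ → Set X, (∀ i, MeasurableSet (g i)) → Pairwise (Function.onFun Disjoint g) →
      ∀ u, HasSum (fun i => T (g i) u) (T (⋃ i, g i) u) := by
    intro g hg hd u
    have hU := MeasurableSet.iUnion hg
    have hS : ∀ s : Finset ℕ, MeasurableSet (⋃ i ∈ s, g i) := fun s =>
      s.measurableSet_biUnion fun i _ => hg i
    have hsub : ∀ s : Finset ℕ, (⋃ i ∈ s, g i) ⊆ ⋃ i, g i := fun s =>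
      iUnion₂_subset fun i _ => subset_iUnion g i
    have hsum : ∀ (s : Finset ℕ) u, (ν u).real (⋃ i ∈ s, g i) = ∑ i ∈ s, (ν u).real (g i) :=
      fun s u => measureReal_biUnion_finset (fun i _ j _ h => hd h) (fun i _ => hg i)
    have hdiff : ∀ s : Finset ℕ,
        T (⋃ i, g i) - ∑ i ∈ s, T (g i) = T ((⋃ i, g i) \ ⋃ i ∈ s, g i) := fun s =>
      ContinuousLinearMap.ext_quadratic fun w => by
        rw [_root_.sub_apply, inner_sub_right, hT _ hU, hT _ (hU.diff (hS s)), _root_.sum_apply,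
          inner_sum, measureReal_sdiff (hsub s) (hS s), hsum]
        simp [hT _ (hg _)]
    have hlim : HasSum (fun i => (ν u).real (g i)) ((ν u).real (⋃ i, g i)) := by
      simpa using hasSum_integral_iUnion hg hd (f := fun _ => (1 : ℝ)) (μ := ν u)
        (integrable_const _).integrableOn
    -- Convergence is strong and not merely weak: each remainder is the projection of a tail set,
    -- and its squared norm at `u` is the scalar measure of that tail.
    have h0 : Tendsto (fun s : Finset ℕ => ‖T (⋃ i, g i) u - ∑ i ∈ s, T (g i) u‖ ^ 2) atTop
        (𝓝 0) := by
      have h : ∀ s : Finset ℕ, ‖T (⋃ i, g i) u - ∑ i ∈ s, T (g i) u‖ ^ 2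
          = (ν u).real (⋃ i, g i) - ∑ i ∈ s, (ν u).real (g i) := fun s => by
        rw [← _root_.sum_apply, ← _root_.sub_apply, hdiff, hnorm _ (hU.diff (hS s)),
          measureReal_sdiff (hsub s) (hS s), hsum]
      simp_rw [h]
      simpa using (tendsto_const_nhds (x := (ν u).real (⋃ i, g i))).sub hlim
    rw [HasSum, SummationFilter.unconditional_filter, tendsto_iff_norm_sub_tendsto_zero]
    have h1 := (Real.continuous_sqrt.tendsto _).comp h0
    simpa [Function.comp_def, Real.sqrt_sq, norm_sub_rev] using h1
  let P : ProjectionValuedMeasure E :=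
    { proj := fun B => if MeasurableSet B then T (φ ⁻¹' B) else 0
      isStarProjection := fun B hB => by
        rw [if_pos hB]
        refine ⟨?_, ?_⟩
        · rw [IsIdempotentElem, ← hmul' _ (hφ hB) _ (hφ hB), inter_self]
        · rw [isSelfAdjoint_iff, ContinuousLinearMap.star_eq_adjoint]
          refine ContinuousLinearMap.ext_quadratic fun u => ?_
          rw [ContinuousLinearMap.adjoint_inner_right, hsa _ (hφ hB)]
      proj_univ := by
        rw [if_pos MeasurableSet.univ]
        refine ContinuousLinearMap.ext_quadratic fun u => ?_
        rw [preimage_univ, hT _ MeasurableSet.univ, hmass, one_apply_eq_self,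
          inner_self_eq_norm_sq_to_K]
        simp
      proj_inter := fun A B hA hB => by
        rw [if_pos hA, if_pos hB, if_pos (hA.inter hB), preimage_inter,
          hmul' _ (hφ hA) _ (hφ hB)]
      hasSum_iUnion := fun f hf hd u => by
        simp only [if_pos (hf _), if_pos (MeasurableSet.iUnion hf), preimage_iUnion]
        have hf' : ∀ i, MeasurableSet (φ ⁻¹' f i) := fun i => hφ (hf i)
        have hd' : Pairwise (Function.onFun Disjoint fun i => φ ⁻¹' f i) :=
          fun i j hij => (hd hij).preimage φ
        exact hunion _ hf' hd' u
      not_measurable := fun B hB => if_neg hB }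
  refine ⟨P, fun u => Measure.ext fun B hB => ?_⟩
  rw [Measure.map_apply hφ hB, ← measureReal_eq_measureReal_iff]
  apply Complex.ofReal_injective
  rw [← P.inner_proj hB, ← hT _ (hφ hB)]
  simp [P, hB]

end ProjectionValuedMeasure

/-! ### Bounded Borel functions and an induction principle -/

/-- Bounded Borel functions on the line. -/
def BoundedMeasurable (f : ℝ → ℂ) : Prop := Measurable f ∧ ∃ C, ∀ x, ‖f x‖ ≤ C

namespace BoundedMeasurable

theorem const (c : ℂ) : BoundedMeasurable fun _ => c := ⟨measurable_const, ‖c‖, fun _ => le_rfl⟩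

theorem indicator_const (c : ℂ) {B : Set ℝ} (hB : MeasurableSet B) :
    BoundedMeasurable (B.indicator fun _ => c) :=
  ⟨measurable_const.indicator hB, ‖c‖, fun _ => norm_indicator_le_norm_self _ _⟩

theorem add {f g : ℝ → ℂ} (hf : BoundedMeasurable f) (hg : BoundedMeasurable g) :
    BoundedMeasurable fun x => f x + g x := by
  obtain ⟨hf, C, hC⟩ := hf
  obtain ⟨hg, D, hD⟩ := hg
  exact ⟨hf.add hg, C + D, fun x => (norm_add_le _ _).trans (add_le_add (hC x) (hD x))⟩

theorem mul {f g : ℝ → ℂ} (hf : BoundedMeasurable f) (hg : BoundedMeasurable g) :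
    BoundedMeasurable fun x => f x * g x := by
  obtain ⟨hf, C, hC⟩ := hf
  obtain ⟨hg, D, hD⟩ := hg
  refine ⟨hf.mul hg, C * D, fun x => ?_⟩
  rw [norm_mul]
  exact mul_le_mul (hC x) (hD x) (norm_nonneg _) ((norm_nonneg _).trans (hC x))

theorem conj {f : ℝ → ℂ} (hf : BoundedMeasurable f) :
    BoundedMeasurable fun x => (starRingEnd ℂ) (f x) := by
  obtain ⟨hf, C, hC⟩ := hf
  exact ⟨Complex.continuous_conj.measurable.comp hf, C, fun x => by simpa using hC x⟩

theorem integrable {f : ℝ → ℂ} (hf : BoundedMeasurable f) (μ : Measure ℝ) [IsFiniteMeasure μ] :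
    Integrable f μ := by
  obtain ⟨hf, C, hC⟩ := hf
  exact .of_bound hf.aestronglyMeasurable C (ae_of_all _ hC)

/-- A bounded measurable function is a pointwise limit of simple functions with a common bound; the
bound `C` in the limit case is there for dominated convergence. -/
theorem induction {p : (ℝ → ℂ) → Prop}
    (indicator : ∀ (c : ℂ) (B : Set ℝ), MeasurableSet B → p (B.indicator fun _ => c))
    (add : ∀ f g, BoundedMeasurable f → BoundedMeasurable g → p f → p g → p fun x => f x + g x)
    (lim : ∀ (f : ℕ → ℝ → ℂ) (g : ℝ → ℂ) (C : ℝ), 0 ≤ C → (∀ n, BoundedMeasurable (f n)) →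
      (∀ n x, ‖f n x‖ ≤ C) → BoundedMeasurable g →
      (∀ x, Tendsto (fun n => f n x) atTop (𝓝 (g x))) → (∀ n, p (f n)) → p g)
    {f : ℝ → ℂ} (hf : BoundedMeasurable f) : p f := by
  have hs : ∀ s : SimpleFunc ℝ ℂ, BoundedMeasurable s := fun s => by
    obtain ⟨C, hC⟩ := s.exists_forall_norm_le
    exact ⟨s.measurable, C, hC⟩
  have hsimple : ∀ s : SimpleFunc ℝ ℂ, p s := fun s => by
    induction s using SimpleFunc.induction with
    | const c hB =>
      rw [SimpleFunc.coe_piecewise, SimpleFunc.coe_const, SimpleFunc.coe_const]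
      convert indicator c _ hB using 1
      ext x; simp [Set.piecewise, Set.indicator]
    | add _ h1 h2 => exact add _ _ (hs _) (hs _) h1 h2
  obtain ⟨C, hC⟩ := hf.2
  have hm := hf.1.stronglyMeasurable
  have hC0 : 0 ≤ C := (norm_nonneg _).trans (hC 0)
  exact lim (fun n => hm.approxBounded C n) f C hC0 (fun n => hs _)
    (fun n x => hm.norm_approxBounded_le hC0 n x) hf
    (fun x => hm.tendsto_approxBounded_of_norm_le (hC x)) (fun n => hsimple _)

end BoundedMeasurable

/-! ### Bounded Borel functional calculus of a projection-valued measure -/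

namespace ProjectionValuedMeasure

variable {E : Type*} [NormedAddCommGroup E] [InnerProductSpace ℂ E] [CompleteSpace E]

theorem tendsto_setIntegral_measureAt (P : ProjectionValuedMeasure E) {f : ℕ → ℝ → ℂ} {g : ℝ → ℂ}
    {C : ℝ} (hf : ∀ n, BoundedMeasurable (f n)) (hC : ∀ n x, ‖f n x‖ ≤ C)
    (h : ∀ x, Tendsto (fun n => f n x) atTop (𝓝 (g x))) (u : E) (B : Set ℝ) :
    Tendsto (fun n => ∫ x in B, f n x ∂(P.measureAt u)) atTop
      (𝓝 (∫ x in B, g x ∂(P.measureAt u))) :=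
  tendsto_integral_of_dominated_convergence (fun _ => C)
    (fun n => (hf n).1.aestronglyMeasurable) (integrable_const C)
    (fun n => ae_of_all _ (hC n)) (ae_of_all _ h)

/-- The case `B = univ` already determines the operator. Having every `B` supplies the indicator
case of `integral_mul`. -/
theorem exists_integral (P : ProjectionValuedMeasure E) {f : ℝ → ℂ} (hf : BoundedMeasurable f) :
    ∃ T : E →L[ℂ] E, ∀ B, MeasurableSet B → ∀ u,
      inner ℂ u (P.proj B (T u)) = ∫ x in B, f x ∂(P.measureAt u) := by
  refine BoundedMeasurable.induction (p := fun f => ∃ T : E →L[ℂ] E, ∀ B, MeasurableSet B → ∀ u,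
      inner ℂ u (P.proj B (T u)) = ∫ x in B, f x ∂(P.measureAt u)) (fun c A hA => ?_)
    (fun f g hf hg ihf ihg => ?_) (fun f g C hC0 hf hC hg hlim ih => ?_) hf
  · refine ⟨c • P.proj A, fun B hB u => ?_⟩
    rw [_root_.smul_apply, map_smul, inner_smul_right, P.proj_proj_apply hB hA,
      P.inner_proj (hB.inter hA), setIntegral_indicator hA]
    simp [mul_comm]
  · obtain ⟨S, hS⟩ := ihf
    obtain ⟨T, hT⟩ := ihg
    refine ⟨S + T, fun B hB u => ?_⟩
    rw [_root_.add_apply, map_add, inner_add_right, hS B hB, hT B hB,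
      integral_add (hf.integrable _) (hg.integrable _)]
  · choose T hT using ih
    have hT1 : ∀ n u, inner ℂ u (T n u) = ∫ x, f n x ∂(P.measureAt u) := fun n u => by
      simpa [P.proj_univ] using hT n univ MeasurableSet.univ u
    have hq : ∀ u, Tendsto (fun n => inner ℂ u (T n u)) atTop
        (𝓝 (∫ x, g x ∂(P.measureAt u))) := fun u => by
      simpa [hT1] using P.tendsto_setIntegral_measureAt hf hC hlim u univ
    obtain ⟨S, hS⟩ := ContinuousLinearMap.exists_weak_limit hC0 (fun n u => by
      rw [hT1, ← P.measureAt_real_univ]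
      exact norm_integral_le_of_norm_le_const (ae_of_all _ (hC n))) hq
    refine ⟨S, fun B hB u => ?_⟩
    rw [← P.inner_proj_left hB]
    refine tendsto_nhds_unique (ContinuousLinearMap.tendsto_inner_of_tendsto_quadratic
      (T := T) (S := S) (l := atTop) (by simpa only [hS] using hq) _ _) ?_
    simp only [P.inner_proj_left hB, hT _ B hB]
    exact P.tendsto_setIntegral_measureAt hf hC hlim u B

open Classical in
/-- The operator `∫ f dP` for bounded measurable `f` (and `0` for other `f`). -/
noncomputable def integral (P : ProjectionValuedMeasure E) (f : ℝ → ℂ) : E →L[ℂ] E :=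
  if h : BoundedMeasurable f then (P.exists_integral h).choose else 0

variable (P : ProjectionValuedMeasure E) {f g : ℝ → ℂ}

theorem inner_proj_integral (hf : BoundedMeasurable f) {B : Set ℝ} (hB : MeasurableSet B) (u : E) :
    inner ℂ u (P.proj B (P.integral f u)) = ∫ x in B, f x ∂(P.measureAt u) := by
  rw [integral, dif_pos hf]
  exact (P.exists_integral hf).choose_spec B hB u

theorem inner_integral (hf : BoundedMeasurable f) (u : E) :
    inner ℂ u (P.integral f u) = ∫ x, f x ∂(P.measureAt u) := by
  simpa [P.proj_univ] using P.inner_proj_integral hf MeasurableSet.univ u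

theorem eq_integral {T : E →L[ℂ] E} (hf : BoundedMeasurable f)
    (h : ∀ u, inner ℂ u (T u) = ∫ x, f x ∂(P.measureAt u)) : P.integral f = T :=
  ContinuousLinearMap.ext_quadratic fun u => by rw [P.inner_integral hf, h]

theorem integral_const (c : ℂ) : P.integral (fun _ => c) = c • 1 :=
  P.eq_integral (.const c) fun u => by
    rw [_root_.smul_apply, inner_smul_right, one_apply_eq_self, inner_self_eq_norm_sq_to_K,
      MeasureTheory.integral_const, P.measureAt_real_univ]
    simp [mul_comm]

theorem integral_indicator_const (c : ℂ) {B : Set ℝ} (hB : MeasurableSet B) :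
    P.integral (B.indicator fun _ => c) = c • P.proj B :=
  P.eq_integral (.indicator_const c hB) fun u => by
    rw [_root_.smul_apply, inner_smul_right, P.inner_proj hB, integral_indicator hB]
    simp [mul_comm]

theorem integral_add (hf : BoundedMeasurable f) (hg : BoundedMeasurable g) :
    P.integral (fun x => f x + g x) = P.integral f + P.integral g :=
  P.eq_integral (hf.add hg) fun u => by
    rw [_root_.add_apply, inner_add_right, P.inner_integral hf, P.inner_integral hg,
      MeasureTheory.integral_add (hf.integrable _) (hg.integrable _)]

theorem integral_conj (hf : BoundedMeasurable f) :
    P.integral (fun x => (starRingEnd ℂ) (f x)) = star (P.integral f) :=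
  P.eq_integral hf.conj fun u => by
    rw [ContinuousLinearMap.star_eq_adjoint, ContinuousLinearMap.adjoint_inner_right,
      ← inner_conj_symm, P.inner_integral hf, _root_.integral_conj]

theorem integral_mul (hf : BoundedMeasurable f) (hg : BoundedMeasurable g) :
    P.integral (fun x => f x * g x) = P.integral f * P.integral g := by
  refine P.eq_integral (hf.mul hg) fun u => ?_
  rw [mul_apply_eq_comp]
  refine BoundedMeasurable.induction (p := fun f => inner ℂ u (P.integral f (P.integral g u))
      = ∫ x, f x * g x ∂(P.measureAt u)) (fun c B hB => ?_)
    (fun f₁ f₂ h₁ h₂ ih₁ ih₂ => ?_) (fun f f' C hC0 hf hC hf' hlim ih => ?_) hf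
  · rw [P.integral_indicator_const c hB, _root_.smul_apply, inner_smul_right,
      P.inner_proj_integral hg hB, ← integral_indicator hB, ← MeasureTheory.integral_const_mul]
    congr 1; ext x; by_cases hx : x ∈ B <;> simp [hx]
  · rw [P.integral_add h₁ h₂, _root_.add_apply, inner_add_right, ih₁, ih₂,
      ← MeasureTheory.integral_add ((h₁.mul hg).integrable _) ((h₂.mul hg).integrable _)]
    simp only [add_mul]
  · refine tendsto_nhds_unique (ContinuousLinearMap.tendsto_inner_of_tendsto_quadratic
      (T := fun n => P.integral (f n)) (l := atTop) (fun w => ?_) _ _) ?_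
    · simp only [P.inner_integral (hf _), P.inner_integral hf']
      simpa using P.tendsto_setIntegral_measureAt hf hC hlim w univ
    · simp only [ih]
      obtain ⟨D, hD⟩ := hg.2
      simpa using P.tendsto_setIntegral_measureAt (f := fun n x => f n x * g x)
        (g := fun x => f' x * g x) (C := C * D) (fun n => (hf n).mul hg)
        (fun n x => by
          rw [norm_mul]
          exact mul_le_mul (hC n x) (hD x) (norm_nonneg _) hC0)
        (fun x => (hlim x).mul_const _) u univ

/-- `⟨f(P) u, g(P) u⟩ = ∫ conj f * g dμ_u`. -/
theorem inner_integral_integral (hf : BoundedMeasurable f) (hg : BoundedMeasurable g) (u : E) :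
    inner ℂ (P.integral f u) (P.integral g u)
      = ∫ x, (starRingEnd ℂ) (f x) * g x ∂(P.measureAt u) := by
  rw [← P.inner_integral (hf.conj.mul hg), P.integral_mul hf.conj hg, P.integral_conj hf,
    mul_apply_eq_comp, ContinuousLinearMap.star_eq_adjoint, ContinuousLinearMap.adjoint_inner_right]

theorem norm_integral_apply_sq (hf : BoundedMeasurable f) (u : E) :
    ‖P.integral f u‖ ^ 2 = ∫ x, ‖f x‖ ^ 2 ∂(P.measureAt u) := by
  have h := P.inner_integral_integral hf hf u
  rw [inner_self_eq_norm_sq_to_K] at h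
  simp only [Complex.conj_mul'] at h
  have h2 := _root_.integral_ofReal (𝕜 := ℂ) (μ := P.measureAt u) (f := fun x => ‖f x‖ ^ 2)
  apply Complex.ofReal_injective
  simp only [Complex.coe_algebraMap, Complex.ofReal_pow] at h h2 ⊢
  rw [h, ← h2]

theorem norm_integral_apply_le {C : ℝ} (hf : Measurable f) (hC : ∀ x, ‖f x‖ ≤ C) (u : E) :
    ‖P.integral f u‖ ≤ C * ‖u‖ := by
  have hC0 : 0 ≤ C := (norm_nonneg _).trans (hC 0)
  refine abs_le_of_sq_le_sq' ?_ (by positivity) |>.2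
  rw [P.norm_integral_apply_sq ⟨hf, C, hC⟩, mul_pow, ← P.measureAt_real_univ]
  refine (integral_mono_of_nonneg (ae_of_all _ fun x => by positivity) (integrable_const (C ^ 2))
    (ae_of_all _ fun x => by dsimp only; gcongr; exact hC x)).trans_eq ?_
  simp [mul_comm]

theorem proj_integral_apply (hf : BoundedMeasurable f) {B : Set ℝ} (hB : MeasurableSet B) (u : E) :
    P.proj B (P.integral f u) = P.integral (B.indicator f) u := by
  have h := P.integral_mul (.indicator_const 1 hB) hf
  rw [P.integral_indicator_const 1 hB, one_smul] at h
  rw [← mul_apply_eq_comp, ← h]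
  congr 2; ext x; by_cases hx : x ∈ B <;> simp [hx]

/-- Since `P(B) f(P) u = (1_B f)(P) u`, the mass of `B` is a squared norm, which
`norm_integral_apply_sq` evaluates. -/
theorem measureAt_integral_apply (hf : BoundedMeasurable f) (u : E) :
    P.measureAt (P.integral f u)
      = (P.measureAt u).withDensity fun x => ENNReal.ofReal (‖f x‖ ^ 2) := by
  have hfin : Integrable (fun x => ‖f x‖ ^ 2) (P.measureAt u) := by
    obtain ⟨hf, C, hC⟩ := hf
    refine .of_bound (by fun_prop) (C ^ 2) (ae_of_all _ fun x => ?_)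
    rw [norm_pow, norm_norm]
    gcongr
    exact hC x
  ext B hB
  have hfB : BoundedMeasurable (B.indicator f) := by
    obtain ⟨hf, C, hC⟩ := hf
    exact ⟨hf.indicator hB, C, fun x => (norm_indicator_le_norm_self _ _).trans (hC x)⟩
  have hreal : (P.measureAt (P.integral f u)).real B = ∫ x in B, ‖f x‖ ^ 2 ∂(P.measureAt u) := by
    apply Complex.ofReal_injective
    rw [← P.inner_proj hB, ← inter_self B, ← P.proj_proj_apply hB hB, ← P.inner_proj_left hB,
      inter_self, P.proj_integral_apply hf hB, inner_self_eq_norm_sq_to_K,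
      ← integral_indicator hB]
    have h := P.norm_integral_apply_sq hfB u
    simp only [Complex.coe_algebraMap, ← Complex.ofReal_pow, h]
    congr 2; ext x; by_cases hx : x ∈ B <;> simp [hx]
  rw [withDensity_apply _ hB, ← ofReal_integral_eq_lintegral_ofReal hfin.restrict
    (ae_of_all _ fun x => by positivity), ← hreal, ofReal_measureReal]

end ProjectionValuedMeasure

/-! ### Self-adjoint operators and their resolvents -/

section SelfAdjoint

variable {E : Type*} [NormedAddCommGroup E] [InnerProductSpace ℂ E] [CompleteSpace E]
variable {T : E →ₗ.[ℂ] E}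

theorem IsSelfAdjoint.inner_apply_left (hT : IsSelfAdjoint T) (x y : T.domain) :
    inner ℂ (T x) (y : E) = inner ℂ (x : E) (T y) := by
  have h := LinearPMap.adjoint_isFormalAdjoint hT.dense_domain
  rw [LinearPMap.isSelfAdjoint_def.1 hT] at h
  exact h x y

/-- This is the inclusion of the domain of the adjoint in that of `T`. It is used both to close
limits and to place vectors in the domain. -/
theorem IsSelfAdjoint.exists_apply_eq (hT : IsSelfAdjoint T) {y w : E}
    (h : ∀ x : T.domain, inner ℂ w (x : E) = inner ℂ y (T x)) : ∃ hy : y ∈ T.domain, T ⟨y, hy⟩ = w := by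
  have hy : y ∈ T.adjoint.domain := LinearPMap.mem_adjoint_domain_of_exists y ⟨w, h⟩
  have hw := LinearPMap.adjoint_apply_eq hT.dense_domain ⟨y, hy⟩ h
  have hT' := LinearPMap.isSelfAdjoint_def.1 hT
  generalize T.adjoint = S at hy hw hT'
  subst hT'
  exact ⟨hy, hw⟩

/-- Because `⟨x, T x⟩` is real, `⟨x, (T - z) x⟩` has imaginary part `-Im z ‖x‖²`; Cauchy–Schwarz
concludes. -/
theorem IsSelfAdjoint.im_mul_norm_le (hT : IsSelfAdjoint T) (z : ℂ) (x : T.domain) :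
    |z.im| * ‖(x : E)‖ ≤ ‖T x - z • (x : E)‖ := by
  have h1 : (inner ℂ (x : E) (T x)).im = 0 := by
    rw [← Complex.conj_eq_iff_im, inner_conj_symm, hT.inner_apply_left]
  have h2 : (inner ℂ (x : E) (T x - z • (x : E))).im = -(z.im * ‖(x : E)‖ ^ 2) := by
    rw [inner_sub_right, inner_smul_right, inner_self_eq_norm_sq_to_K, Complex.sub_im, h1]
    simp [← Complex.ofReal_pow]
  rcases eq_or_ne (x : E) 0 with hx | hx
  · rw [hx]; simp
  have hx' : 0 < ‖(x : E)‖ := norm_pos_iff.2 hx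
  refine le_of_mul_le_mul_left ?_ hx'
  calc ‖(x : E)‖ * (|z.im| * ‖(x : E)‖) = |(inner ℂ (x : E) (T x - z • (x : E))).im| := by
        rw [h2, abs_neg, abs_mul, abs_of_nonneg (sq_nonneg ‖(x : E)‖)]; ring
    _ ≤ ‖inner ℂ (x : E) (T x - z • (x : E))‖ := Complex.abs_im_le_norm _
    _ ≤ _ := norm_inner_le_norm _ _

/-- `R = (T - z)⁻¹`, as a right inverse. -/
def IsResolventAt (T : E →ₗ.[ℂ] E) (z : ℂ) (R : E →L[ℂ] E) : Prop :=
  ∀ v, ∃ h : R v ∈ T.domain, T ⟨R v, h⟩ = v + z • R v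

/-- For non-real `z` the operator `T - z` is injective, so the right inverse is also a left inverse.
This is how resolvents are computed: exhibit a solution of `(T - z) u = v`. -/
theorem IsResolventAt.apply_eq (hT : IsSelfAdjoint T) {z : ℂ} (hz : z.im ≠ 0) {R : E →L[ℂ] E}
    (hR : IsResolventAt T z R) {v u : E} (hu : u ∈ T.domain) (h : T ⟨u, hu⟩ = v + z • u) :
    R v = u := by
  obtain ⟨hm, hv⟩ := hR v
  have h1 := hT.im_mul_norm_le z (⟨R v, hm⟩ - ⟨u, hu⟩)
  rw [T.map_sub, hv, h] at h1
  have h2 : v + z • R v - (v + z • u) - z • ((⟨R v, hm⟩ - ⟨u, hu⟩ : T.domain) : E) = 0 := by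
    simp only [Submodule.coe_sub, smul_sub]; abel
  rw [h2, norm_zero] at h1
  have h3 : 0 < |z.im| := abs_pos.2 hz
  have h4 : ‖((⟨R v, hm⟩ - ⟨u, hu⟩ : T.domain) : E)‖ ≤ 0 := by
    by_contra hc
    push Not at hc
    nlinarith
  have h5 := norm_le_zero_iff.1 h4
  simpa [sub_eq_zero] using h5

theorem IsResolventAt.unique (hT : IsSelfAdjoint T) {z : ℂ} (hz : z.im ≠ 0) {R S : E →L[ℂ] E}
    (hR : IsResolventAt T z R) (hS : IsResolventAt T z S) : R = S :=
  ContinuousLinearMap.ext fun v => hR.apply_eq hT hz (hS v).1 (hS v).2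

/-- The resolvent of a self-adjoint operator exists off the real line. -/
theorem IsSelfAdjoint.exists_isResolventAt (hT : IsSelfAdjoint T) {z : ℂ} (hz : z.im ≠ 0) :
    ∃ R : E →L[ℂ] E, IsResolventAt T z R := by
  have h0 : 0 < |z.im| := abs_pos.2 hz
  let L : T.domain →ₗ[ℂ] E := T.toFun - z • T.domain.subtype
  have hL : ∀ x, L x = T x - z • (x : E) := fun x => rfl
  have hLb : ∀ x : T.domain, ‖(x : E)‖ ≤ |z.im|⁻¹ * ‖L x‖ := fun x => by
    rw [hL, inv_mul_eq_div, le_div_iff₀' h0]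
    exact hT.im_mul_norm_le z x
  -- The lower bound makes preimages of a convergent sequence Cauchy, and self-adjointness makes `T`
  -- closed.
  have hclosed : IsClosed (LinearMap.range L : Set E) := by
    refine IsSeqClosed.isClosed fun y y₀ hy hlim => ?_
    choose x hx using hy
    have hc : CauchySeq fun n => (x n : E) := by
      rw [Metric.cauchySeq_iff']
      intro ε hε
      obtain ⟨N, hN⟩ := Metric.cauchySeq_iff'.1 hlim.cauchySeq (|z.im| * ε) (by positivity)
      refine ⟨N, fun n hn => ?_⟩
      have h1 := hLb (x n - x N)
      have h2 := hN n hn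
      rw [map_sub, hx, hx, Submodule.coe_sub, ← dist_eq_norm, ← dist_eq_norm] at h1
      refine h1.trans_lt ?_
      rw [inv_mul_eq_div, div_lt_iff₀' h0]
      exact h2
    obtain ⟨u, hu⟩ := cauchySeq_tendsto_of_complete hc
    have hTx : Tendsto (fun n => T (x n)) atTop (𝓝 (y₀ + z • u)) := by
      have : ∀ n, T (x n) = y n + z • (x n : E) := fun n => by rw [← hx, hL]; abel
      simp_rw [this]
      exact hlim.add (hu.const_smul z)
    obtain ⟨hm, he⟩ := hT.exists_apply_eq (y := u) (w := y₀ + z • u) (fun w => by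
      refine tendsto_nhds_unique ((hTx.inner tendsto_const_nhds)) ?_
      simp_rw [hT.inner_apply_left]
      exact hu.inner tendsto_const_nhds)
    exact ⟨⟨u, hm⟩, by rw [hL, he]; simp⟩
  -- A vector orthogonal to the range is an eigenvector for `conj z`, which the lower bound at `conj
  -- z` excludes unless it vanishes.
  have hsurj : LinearMap.range L = ⊤ := by
    have : CompleteSpace (LinearMap.range L) := hclosed.completeSpace_coe
    rw [← Submodule.orthogonal_eq_bot_iff, Submodule.eq_bot_iff]
    intro v hv
    rw [Submodule.mem_orthogonal'] at hv
    obtain ⟨hm, he⟩ := hT.exists_apply_eq (y := v) (w := (starRingEnd ℂ) z • v) (fun x => by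
      have h := hv (L x) ⟨x, rfl⟩
      rw [hL, inner_sub_right, inner_smul_right, sub_eq_zero] at h
      rw [inner_smul_left, Complex.conj_conj, h])
    have h := hT.im_mul_norm_le ((starRingEnd ℂ) z) ⟨v, hm⟩
    rw [he, sub_self, norm_zero, Complex.conj_im, abs_neg] at h
    by_contra hc
    have : 0 < ‖v‖ := norm_pos_iff.2 hc
    have := mul_pos h0 this
    exact absurd h (not_le.2 this)
  have hinj : Function.Injective L := by
    rw [injective_iff_map_eq_zero]
    intro x hx
    have h := hLb x
    rw [hx, norm_zero, mul_zero] at h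
    exact Subtype.ext (norm_le_zero_iff.1 h)
  let e := LinearEquiv.ofBijective L ⟨hinj, LinearMap.range_eq_top.1 hsurj⟩
  have he : ∀ v, L (e.symm v) = v := fun v => e.apply_symm_apply v
  refine ⟨LinearMap.mkContinuous (T.domain.subtype ∘ₗ e.symm.toLinearMap) |z.im|⁻¹ fun v => ?_,
    fun v => ⟨(e.symm v).2, ?_⟩⟩
  · have := hLb (e.symm v)
    rwa [he] at this
  · have h := he v
    rw [hL] at h
    exact eq_add_of_sub_eq h

theorem IsResolventAt.star_eq (hT : IsSelfAdjoint T) {z : ℂ} {R S : E →L[ℂ] E}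
    (hR : IsResolventAt T z R) (hS : IsResolventAt T ((starRingEnd ℂ) z) S) : star R = S := by
  refine ContinuousLinearMap.ext fun w => ext_inner_left ℂ fun v => ?_
  rw [ContinuousLinearMap.star_eq_adjoint, ContinuousLinearMap.adjoint_inner_right]
  obtain ⟨h1, e1⟩ := hR v
  obtain ⟨h2, e2⟩ := hS w
  have h := hT.inner_apply_left ⟨R v, h1⟩ ⟨S w, h2⟩
  rw [e1, e2, inner_add_left, inner_add_right, inner_smul_left, inner_smul_right] at h
  simpa using h.symm

/-- The first resolvent identity. -/
theorem IsResolventAt.sub_eq (hT : IsSelfAdjoint T) {z w : ℂ} (hz : z.im ≠ 0) {R S : E →L[ℂ] E}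
    (hR : IsResolventAt T z R) (hS : IsResolventAt T w S) : R - S = (z - w) • (R * S) := by
  refine ContinuousLinearMap.ext fun v => ?_
  obtain ⟨h1, e1⟩ := hR v
  obtain ⟨h2, e2⟩ := hS v
  have h := hR.apply_eq hT hz (v := (z - w) • S v) (u := - S v + R v)
    (T.domain.add_mem (T.domain.neg_mem h2) h1) (by
      have : (⟨- S v + R v, T.domain.add_mem (T.domain.neg_mem h2) h1⟩ : T.domain)
        = - ⟨S v, h2⟩ + ⟨R v, h1⟩ := rfl
      rw [this, T.map_add, T.map_neg, e1, e2]
      module)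
  rw [_root_.sub_apply, _root_.smul_apply, mul_apply_eq_comp, ← map_smul, h]
  abel

end SelfAdjoint

/-! ### The Cauchy kernel -/

/-- The function `x ↦ 1 / (x - z)`. -/
noncomputable def cauchyKernel (z : ℂ) (x : ℝ) : ℂ := ((x : ℂ) - z)⁻¹

section Kernel

variable {z : ℂ}

theorem ofReal_sub_ne_zero (hz : z.im ≠ 0) (x : ℝ) : (x : ℂ) - z ≠ 0 := fun h => by
  have := congrArg Complex.im h
  simp [hz] at this

theorem measurable_cauchyKernel (z : ℂ) : Measurable (cauchyKernel z) := by
  unfold cauchyKernel; fun_prop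

theorem norm_cauchyKernel_le (hz : z.im ≠ 0) (x : ℝ) : ‖cauchyKernel z x‖ ≤ |z.im|⁻¹ := by
  rw [cauchyKernel, norm_inv]
  refine inv_anti₀ (abs_pos.2 hz) ?_
  simpa using Complex.abs_im_le_norm ((x : ℂ) - z)

theorem boundedMeasurable_cauchyKernel (hz : z.im ≠ 0) : BoundedMeasurable (cauchyKernel z) :=
  ⟨measurable_cauchyKernel z, _, norm_cauchyKernel_le hz⟩

theorem ofReal_mul_cauchyKernel (hz : z.im ≠ 0) (x : ℝ) :
    (x : ℂ) * cauchyKernel z x = 1 + z * cauchyKernel z x := by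
  have := ofReal_sub_ne_zero hz x
  rw [cauchyKernel]
  field_simp
  ring

theorem im_cauchyKernel (z : ℂ) (x : ℝ) :
    (cauchyKernel z x).im = z.im / ((x - z.re) ^ 2 + z.im ^ 2) := by
  rw [cauchyKernel, Complex.inv_im, Complex.normSq_apply]
  simp
  ring

theorem conj_cauchyKernel (z : ℂ) (x : ℝ) :
    (starRingEnd ℂ) (cauchyKernel z x) = cauchyKernel ((starRingEnd ℂ) z) x := by
  simp [cauchyKernel]

theorem sq_mul_norm_cauchyKernel_sq_le (hz : z.im ≠ 0) (x : ℝ) :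
    x ^ 2 * ‖cauchyKernel z x‖ ^ 2 ≤ (1 + ‖z‖ * |z.im|⁻¹) ^ 2 := by
  have h : |x| * ‖cauchyKernel z x‖ ≤ 1 + ‖z‖ * |z.im|⁻¹ := by
    have h1 := congrArg norm (ofReal_mul_cauchyKernel hz x)
    rw [norm_mul, Complex.norm_real, Real.norm_eq_abs] at h1
    rw [h1]
    refine (norm_add_le _ _).trans ?_
    rw [norm_one, norm_mul]
    gcongr
    exact norm_cauchyKernel_le hz x
  rw [← sq_abs x, ← mul_pow]
  gcongr

end Kernel

/-! ### Spectral measures correspond to resolvents -/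

section Spectral

variable {E : Type*} [NormedAddCommGroup E] [InnerProductSpace ℂ E] [CompleteSpace E]
variable {T : E →ₗ.[ℂ] E} {P : ProjectionValuedMeasure E} {z : ℂ}

namespace ProjectionValuedMeasure

theorem integrable_sq_measureAt_integral_cauchyKernel (P : ProjectionValuedMeasure E)
    (hz : z.im ≠ 0) (v : E) :
    Integrable (fun x : ℝ => x ^ 2) (P.measureAt (P.integral (cauchyKernel z) v)) := by
  have hm := measurable_cauchyKernel z
  rw [P.measureAt_integral_apply (boundedMeasurable_cauchyKernel hz),
    integrable_withDensity_iff (by fun_prop) (ae_of_all _ fun x => ENNReal.ofReal_lt_top)]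
  refine .of_bound (by fun_prop) ((1 + ‖z‖ * |z.im|⁻¹) ^ 2) (ae_of_all _ fun x => ?_)
  rw [ENNReal.toReal_ofReal (by positivity), Real.norm_eq_abs, abs_of_nonneg (by positivity)]
  exact sq_mul_norm_cauchyKernel_sq_le hz x

/-- `⟨R v, v + z R v⟩ = ∫ x dμ_{R v}` where `R = ∫ (x - z)⁻¹ dP`. -/
theorem inner_integral_cauchyKernel (P : ProjectionValuedMeasure E) (hz : z.im ≠ 0) (v : E) :
    inner ℂ (P.integral (cauchyKernel z) v) (v + z • P.integral (cauchyKernel z) v)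
      = ((∫ x : ℝ, x ∂(P.measureAt (P.integral (cauchyKernel z) v)) : ℝ) : ℂ) := by
  have hb := boundedMeasurable_cauchyKernel hz
  have hm := measurable_cauchyKernel z
  have h1 : v + z • P.integral (cauchyKernel z) v
      = P.integral (fun x => 1 + z * cauchyKernel z x) v := by
    rw [P.integral_add (.const 1) ((BoundedMeasurable.const z).mul hb),
      P.integral_mul (.const z) hb, P.integral_const, P.integral_const]
    simp
  rw [h1, P.inner_integral_integral hb ((BoundedMeasurable.const 1).add
    ((BoundedMeasurable.const z).mul hb)), P.measureAt_integral_apply hb,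
    integral_withDensity_eq_integral_toReal_smul (by fun_prop)
      (ae_of_all _ fun x => ENNReal.ofReal_lt_top), ← integral_complex_ofReal]
  congr 1
  ext x
  rw [← ofReal_mul_cauchyKernel hz, ENNReal.toReal_ofReal (by positivity), smul_eq_mul,
    mul_left_comm, Complex.conj_mul']
  push_cast
  ring

theorem eq_zero_of_integral_eq_zero (P : ProjectionValuedMeasure E) {f : ℝ → ℂ}
    (hf : BoundedMeasurable f) (h0 : ∀ x, f x ≠ 0) {u : E} (h : P.integral f u = 0) : u = 0 := by
  have h1 := P.measureAt_integral_apply hf u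
  rw [h] at h1
  have h2 : P.measureAt (0 : E) = 0 := by
    rw [← Measure.measure_univ_eq_zero, P.measureAt_univ]; simp
  rw [h2, eq_comm, withDensity_eq_zero_iff (by have := hf.1; fun_prop)] at h1
  have h3 : P.measureAt u = 0 := by
    rw [← ae_eq_bot, ← Filter.eventually_false_iff_eq_bot]
    filter_upwards [h1] with x hx
    have := norm_pos_iff.2 (h0 x)
    simp only [Pi.zero_apply, ENNReal.ofReal_eq_zero] at hx
    have : 0 < ‖f x‖ ^ 2 := by positivity
    linarith
  have h4 := P.measureAt_real_univ u
  rw [h3] at h4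
  simpa using h4.symm

end ProjectionValuedMeasure

/-- With `S = ∫ (x - z)⁻¹ dP` and `A = T S - 1 - z S`, the diagonal identity for `T` says `⟨S v, A
v⟩ = 0` for all `v`. Hence `S* A = 0` by polarization, and `S*` is injective because its kernel
function never vanishes. -/
theorem IsSpectralMeasureOf.isResolventAt (hP : IsSpectralMeasureOf T P) (hz : z.im ≠ 0) :
    IsResolventAt T z (P.integral (cauchyKernel z)) := by
  have hb := boundedMeasurable_cauchyKernel hz
  let S := P.integral (cauchyKernel z)
  have hdom : ∀ v, S v ∈ T.domain := fun v =>
    (hP.mem_domain_iff _).2 (P.integrable_sq_measureAt_integral_cauchyKernel hz v)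
  let A : E →ₗ[ℂ] E := T.toFun ∘ₗ S.toLinearMap.codRestrict T.domain hdom - LinearMap.id
    - z • S.toLinearMap
  have hA : ∀ v, A v = T ⟨S v, hdom v⟩ - v - z • S v := fun v => rfl
  have hzero : (star S).toLinearMap ∘ₗ A = 0 := by
    rw [← inner_map_self_eq_zero]
    intro v
    rw [← inner_conj_symm, map_eq_zero]
    change inner ℂ v (star S (A v)) = 0
    rw [ContinuousLinearMap.star_eq_adjoint, ContinuousLinearMap.adjoint_inner_right, hA,
      sub_sub, inner_sub_right, sub_eq_zero]
    exact (hP.inner_apply ⟨S v, hdom v⟩).trans (P.inner_integral_cauchyKernel hz v).symm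
  refine fun v => ⟨hdom v, ?_⟩
  have h1 : star S (A v) = 0 := LinearMap.congr_fun hzero v
  rw [← P.integral_conj hb] at h1
  have h2 := P.eq_zero_of_integral_eq_zero hb.conj (fun x => by
    rw [conj_cauchyKernel]
    exact inv_ne_zero (ofReal_sub_ne_zero (by simpa using hz) x)) h1
  rw [hA, sub_sub, sub_eq_zero] at h2
  exact h2

theorem IsResolventAt.isSpectralMeasureOf (hT : IsSelfAdjoint T) (hz : z.im ≠ 0)
    (hR : IsResolventAt T z (P.integral (cauchyKernel z))) : IsSpectralMeasureOf T P := by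
  have hb := boundedMeasurable_cauchyKernel hz
  have hran : ∀ u : T.domain, ∃ v, P.integral (cauchyKernel z) v = u := fun u =>
    ⟨T u - z • (u : E), hR.apply_eq hT hz u.2 (by simp)⟩
  refine ⟨fun u => ⟨fun hu => ?_, fun hu => ?_⟩, fun u => ?_⟩
  · obtain ⟨v, hv⟩ := hran ⟨u, hu⟩
    rw [show u = _ from hv.symm]
    exact P.integrable_sq_measureAt_integral_cauchyKernel hz v
  -- With `sₙ = (x - z) 1_{[-n, n]}`, the cut-off `P(Bₙ) u` is the resolvent of `sₙ(P) u`, hence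
  -- lies in the domain. Since `|x - z|² ≤ 2x² + 2|z|²`, the vectors `T P(Bₙ) u` stay bounded. So `y
  -- ↦ ⟨u, T y⟩`, the limit of `⟨T P(Bₙ) u, y⟩`, is a bounded functional, and `u` lies in the domain
  -- of the adjoint.
  · let B : ℕ → Set ℝ := fun n => Icc (-(n : ℝ)) n
    have hB : ∀ n, MeasurableSet (B n) := fun n => measurableSet_Icc
    let s : ℕ → ℝ → ℂ := fun n => (B n).indicator fun x => (x : ℂ) - z
    have hs : ∀ n, BoundedMeasurable (s n) := fun n => by
      refine ⟨Measurable.indicator (by fun_prop) (hB n), n + ‖z‖, fun x => ?_⟩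
      by_cases hx : x ∈ B n
      · simp only [s, indicator_of_mem hx]
        refine (norm_sub_le _ _).trans ?_
        gcongr
        rw [Complex.norm_real]
        exact abs_le.2 hx
      · simp only [s, indicator_of_notMem hx, norm_zero]
        positivity
    have hRs : ∀ n, P.integral (cauchyKernel z) (P.integral (s n) u) = P.proj (B n) u := fun n => by
      rw [← mul_apply_eq_comp, ← P.integral_mul hb (hs n)]
      have h := P.integral_indicator_const 1 (hB n)
      rw [one_smul] at h
      rw [← h]
      congr 2
      ext x
      by_cases hx : x ∈ B n
      · simp [s, hx, cauchyKernel, ofReal_sub_ne_zero hz]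
      · simp [s, hx]
    have hbound : ∃ C, 0 ≤ C ∧ ∀ n, ‖P.integral (s n) u‖ ≤ C := by
      refine ⟨√(∫ x, (2 * x ^ 2 + 2 * ‖z‖ ^ 2) ∂(P.measureAt u)), Real.sqrt_nonneg _, fun n => ?_⟩
      refine Real.le_sqrt_of_sq_le ?_
      rw [P.norm_integral_apply_sq (hs n)]
      refine integral_mono_of_nonneg (ae_of_all _ fun x => by positivity)
        ((hu.const_mul 2).add (integrable_const _)) (ae_of_all _ fun x => ?_)
      by_cases hx : x ∈ B n
      · simp only [s, indicator_of_mem hx]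
        have h1 : ‖(x : ℂ) - z‖ ≤ |x| + ‖z‖ := by
          refine (norm_sub_le _ _).trans ?_
          rw [Complex.norm_real, Real.norm_eq_abs]
        have h2 : ‖(x : ℂ) - z‖ ^ 2 ≤ (|x| + ‖z‖) ^ 2 := by gcongr
        nlinarith [sq_nonneg (|x| - ‖z‖), sq_abs x]
      · simp only [s, indicator_of_notMem hx, norm_zero]
        rw [zero_pow two_ne_zero]
        positivity
    obtain ⟨C, hC0, hC⟩ := hbound
    have hlim : ∀ w, Tendsto (fun n => inner ℂ (P.proj (B n) u) w) atTop (𝓝 (inner ℂ u w)) := by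
      intro w
      have h := ContinuousLinearMap.tendsto_inner_of_tendsto_quadratic
        (T := fun n => P.proj (B n)) (S := 1) (l := atTop) (fun v => ?_) u w
      · simpa only [P.inner_proj_left (hB _), one_apply_eq_self] using h
      · simp only [P.inner_proj (hB _), one_apply_eq_self]
        rw [inner_self_eq_norm_sq_to_K]
        have h : Tendsto (fun n => (P.measureAt v).real (B n)) atTop (𝓝 (‖v‖ ^ 2)) := by
          rw [← P.measureAt_real_univ]
          have hU : (⋃ n, B n) = univ := by
            ext x
            simp only [mem_iUnion, mem_univ, iff_true]
            obtain ⟨n, hn⟩ := exists_nat_ge |x|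
            exact ⟨n, abs_le.1 hn⟩
          rw [← hU]
          refine (ENNReal.tendsto_toReal (measure_ne_top _ _)).comp
            (tendsto_measure_iUnion_atTop ?_)
          intro m n hmn
          have : (m : ℝ) ≤ n := by exact_mod_cast hmn
          exact Icc_subset_Icc (by linarith) this
        have := (Complex.continuous_ofReal.tendsto _).comp h
        simpa [Function.comp_def] using this
    have hcont : u ∈ T.adjoint.domain := by
      rw [LinearPMap.mem_adjoint_domain_iff]
      refine AddMonoidHomClass.continuous_of_bound _ (C + ‖z‖ * ‖u‖ : ℝ) fun y => ?_
      have h2 : Tendsto (fun n => ‖inner ℂ (P.proj (B n) u) (T y)‖) atTop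
          (𝓝 ‖inner ℂ u (T y)‖) := (hlim (T y)).norm
      refine le_of_tendsto h2 (Eventually.of_forall fun n => ?_)
      have h3 := hR (P.integral (s n) u)
      rw [hRs] at h3
      obtain ⟨hm, he⟩ := h3
      rw [← hT.inner_apply_left ⟨_, hm⟩ y, he]
      refine (norm_inner_le_norm _ _).trans ?_
      gcongr
      · refine (norm_add_le _ _).trans (add_le_add (hC n) ?_)
        rw [norm_smul]
        gcongr
        have h4 := P.norm_integral_apply_le (f := (B n).indicator fun _ => 1) (C := 1)
          (measurable_const.indicator (hB n))
          (fun x => (norm_indicator_le_norm_self _ _).trans (by simp)) u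
        rw [P.integral_indicator_const 1 (hB n), one_smul, one_mul] at h4
        exact h4
      · rfl
    rwa [LinearPMap.isSelfAdjoint_def.1 hT] at hcont
  · obtain ⟨v, hv⟩ := hran u
    obtain ⟨hm, he⟩ := hR v
    have : u = ⟨P.integral (cauchyKernel z) v, hm⟩ := Subtype.ext hv.symm
    rw [this, he]
    exact P.inner_integral_cauchyKernel hz v

end Spectral

/-! ### Existence of the spectral measure -/

section Existence

variable {E : Type*} [NormedAddCommGroup E] [InnerProductSpace ℂ E] [CompleteSpace E]
variable {T : E →ₗ.[ℂ] E}

/-- A self-adjoint operator has a spectral measure. -/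
theorem IsSelfAdjoint.exists_isSpectralMeasureOf (hT : IsSelfAdjoint T) :
    ∃ P : ProjectionValuedMeasure E, IsSpectralMeasureOf T P := by
  have hz : (-Complex.I).im ≠ 0 := by simp
  have hz' : Complex.I.im ≠ 0 := by simp
  obtain ⟨R, hR⟩ := hT.exists_isResolventAt hz
  obtain ⟨S, hS⟩ := hT.exists_isResolventAt hz'
  have hstar : star R = S := hR.star_eq hT (by simpa using hS)
  have h1 : R - S = (-2 * Complex.I) • (R * S) := by
    rw [hR.sub_eq hT hz hS]; congr 1; ring
  have h2 : R - S = (-2 * Complex.I) • (S * R) := by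
    rw [← neg_sub, hS.sub_eq hT hz' hR, ← neg_smul]; congr 1; ring
  have hcomm : S * R = R * S :=
    smul_right_injective _ (show (-2 * Complex.I) ≠ 0 by simp) (h2.symm.trans h1)
  have hnormal : IsStarNormal R := ⟨by rw [hstar]; exact hcomm⟩
  let X := spectrum ℂ R
  have hXc : CompactSpace X := isCompact_iff_compactSpace.1 (spectrum.isCompact R)
  let π : C(X, ℂ) →⋆ₐ[ℂ] (E →L[ℂ] E) := cfcHom (R := ℂ) (p := IsStarNormal) hnormal
  let r : C(X, ℂ) := ⟨fun x => x, by fun_prop⟩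
  have hπr : π r = R := cfcHom_id hnormal
  -- The resolvent identity read on the spectrum of `R`: its points lie on the circle through `0` on
  -- which `Im(1/x) = 1` for `x ≠ 0`.
  have hcircle : ∀ x : X, (x : ℂ) - (starRingEnd ℂ) x = (-2 * Complex.I) * (x * (starRingEnd ℂ) x) := by
    have h : r - star r = (-2 * Complex.I) • (r * star r) := by
      apply cfcHom_injective hnormal
      change π _ = π _
      rw [map_sub, map_star, map_smul, map_mul, map_star, hπr, hstar, h1]
    exact fun x => DFunLike.congr_fun h x
  obtain ⟨ν, F, hfin, hν, hF, hmul⟩ := π.exists_spectral_family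
  have hmass : ∀ u, (ν u).real univ = ‖u‖ ^ 2 := fun u => by
    have h := hν 1 u
    rw [map_one, one_apply_eq_self, inner_self_eq_norm_sq_to_K] at h
    simp only [ContinuousMap.one_apply, integral_const, Complex.real_smul, mul_one] at h
    exact Complex.ofReal_injective (by simpa using h.symm)
  have hF1 : ∀ B, MeasurableSet B → ∀ u, inner ℂ u (F B u) = ((ν u).real B : ℂ) :=
    fun B hB u => by simpa using hF B hB 1 u
  let Z : Set X := {x | (x : ℂ) = 0}
  have hZ : MeasurableSet Z := measurableSet_eq_fun measurable_subtype_coe measurable_const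
  -- The point `0` corresponds to infinity on the line. Its projection annihilates the range of `R`,
  -- which contains the dense domain of `T`, so it carries no mass and the default value `0⁻¹ = 0`
  -- in the map below is harmless.
  have hFZ : ∀ u, ν u Z = 0 := by
    have hzero : F Z * R = 0 := ContinuousLinearMap.ext_quadratic fun u => by
      rw [mul_apply_eq_comp, ← hπr, hF Z hZ, setIntegral_eq_zero_of_forall_eq_zero (t := Z) (f := r) (fun x hx => hx)]
      simp
    have hdom : ∀ v ∈ T.domain, F Z v = 0 := fun v hv => by
      have h := hR.apply_eq hT hz hv (v := T ⟨v, hv⟩ + Complex.I • v) (by module)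
      rw [← h, ← mul_apply_eq_comp, hzero]
      simp
    have hFZ0 : F Z = 0 := by
      ext v
      have h := hT.dense_domain.closure_eq
      exact (isClosed_eq (F Z).continuous continuous_const).closure_subset_iff.2 hdom
        (h ▸ mem_univ v)
    intro u
    have h := hF1 Z hZ u
    rw [hFZ0] at h
    have h' : (ν u).real Z = 0 := Complex.ofReal_injective (by simpa using h.symm)
    exact (measureReal_eq_zero_iff).1 h'
  have hφ : Measurable fun x : X => ((x : ℂ)⁻¹).re := by fun_prop
  obtain ⟨P, hP⟩ := ProjectionValuedMeasure.exists_of_spectral_family ν F hmass hF1 hmul hφ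
  have hPR : P.integral (cauchyKernel (-Complex.I)) = R := by
    refine P.eq_integral (boundedMeasurable_cauchyKernel hz) fun u => ?_
    rw [hP, integral_map hφ.aemeasurable (measurable_cauchyKernel _).aestronglyMeasurable, ← hπr,
      hν]
    refine integral_congr_ae ?_
    have hae : ∀ᵐ x ∂(ν u), x ∉ Z := measure_eq_zero_iff_ae_notMem.1 (hFZ u)
    filter_upwards [hae] with x hx
    have hx0 : (x : ℂ) ≠ 0 := hx
    have hc0 : (starRingEnd ℂ) (x : ℂ) ≠ 0 := (map_ne_zero _).2 hx0
    have him : (x : ℂ)⁻¹.im = 1 := by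
      have h := hcircle x
      have h3 : (x : ℂ)⁻¹ - (starRingEnd ℂ) (x : ℂ)⁻¹ = 2 * Complex.I := by
        rw [map_inv₀]
        field_simp
        linear_combination -h
      rw [Complex.sub_conj] at h3
      have := mul_right_cancel₀ Complex.I_ne_zero h3
      have : 2 * (x : ℂ)⁻¹.im = 2 := by exact_mod_cast this
      linarith
    have : ((((x : ℂ)⁻¹).re : ℝ) : ℂ) - -Complex.I = (x : ℂ)⁻¹ := by
      apply Complex.ext <;> simp [him]
    change (x : ℂ) = (((((x : ℂ)⁻¹).re : ℝ) : ℂ) - -Complex.I)⁻¹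
    rw [this, inv_inv]
  exact ⟨P, IsResolventAt.isSpectralMeasureOf hT hz (hPR ▸ hR)⟩

end Existence

/-! ### Compactifying the line in the unit disc -/

section Disc

/-- A compact space holding the values of `(x + i)⁻¹`: polynomials in the resolvent become
polynomials in the coordinate and its conjugate, and tightness is automatic. -/
abbrev UnitDisc : Type := Metric.closedBall (0 : ℂ) 1

/-- The map `x ↦ (x + i)⁻¹` from the line to the unit disc. -/
noncomputable def toUnitDisc (x : ℝ) : UnitDisc :=
  ⟨cauchyKernel (-Complex.I) x, by
    simpa using norm_cauchyKernel_le (z := -Complex.I) (by simp) x⟩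

theorem measurable_toUnitDisc : Measurable toUnitDisc :=
  (measurable_cauchyKernel _).subtype_mk

/-- A left inverse of `toUnitDisc`. -/
noncomputable def ofUnitDisc (y : UnitDisc) : ℝ := ((y : ℂ)⁻¹).re

theorem measurable_ofUnitDisc : Measurable ofUnitDisc := by unfold ofUnitDisc; fun_prop

theorem ofUnitDisc_toUnitDisc (x : ℝ) : ofUnitDisc (toUnitDisc x) = x := by
  simp [ofUnitDisc, toUnitDisc, cauchyKernel]

theorem map_ofUnitDisc_map_toUnitDisc (μ : Measure ℝ) :
    (μ.map toUnitDisc).map ofUnitDisc = μ := by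
  rw [Measure.map_map measurable_ofUnitDisc measurable_toUnitDisc]
  convert Measure.map_id
  ext x
  exact ofUnitDisc_toUnitDisc x

open BoundedContinuousFunction

/-- The coordinate function on the unit disc. -/
noncomputable def unitDiscCoord : UnitDisc →ᵇ ℂ :=
  BoundedContinuousFunction.mkOfCompact ⟨fun y => (y : ℂ), by fun_prop⟩

/-- The polynomials in `y` and `conj y` on the unit disc. -/
noncomputable def unitDiscPolynomials : StarSubalgebra ℂ (UnitDisc →ᵇ ℂ) :=
  StarAlgebra.adjoin ℂ {unitDiscCoord}

theorem separatesPoints_unitDiscPolynomials :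
    (unitDiscPolynomials.map (toContinuousMapStarₐ ℂ)).SeparatesPoints := by
  intro x y hxy
  refine ⟨unitDiscCoord, ⟨toContinuousMapStarₐ ℂ unitDiscCoord, ⟨unitDiscCoord,
    StarAlgebra.self_mem_adjoin_singleton ℂ _, rfl⟩, rfl⟩, fun h => hxy (Subtype.ext h)⟩

theorem boundedMeasurable_comp_toUnitDisc (g : UnitDisc →ᵇ ℂ) :
    BoundedMeasurable fun x => g (toUnitDisc x) :=
  ⟨g.continuous.measurable.comp measurable_toUnitDisc, ‖g‖, fun _ => g.norm_coe_le_norm _⟩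

theorem integral_map_toUnitDisc (g : UnitDisc →ᵇ ℂ) (μ : Measure ℝ) :
    ∫ y, g y ∂(μ.map toUnitDisc) = ∫ x, g (toUnitDisc x) ∂μ :=
  integral_map measurable_toUnitDisc.aemeasurable g.continuous.aestronglyMeasurable

/-- A property of the functions of a projection-valued measure that holds for the resolvent and
is stable under the algebra operations holds for all polynomials in the resolvent. -/
theorem unitDiscPolynomials_induction {p : (ℝ → ℂ) → Prop}
    (coord : p (cauchyKernel (-Complex.I)))
    (const : ∀ c : ℂ, p fun _ => c)
    (add : ∀ f g, BoundedMeasurable f → BoundedMeasurable g → p f → p g → p fun x => f x + g x)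
    (mul : ∀ f g, BoundedMeasurable f → BoundedMeasurable g → p f → p g → p fun x => f x * g x)
    (coord_conj : p (cauchyKernel Complex.I))
    {g : UnitDisc →ᵇ ℂ} (hg : g ∈ unitDiscPolynomials) : p fun x => g (toUnitDisc x) := by
  have hb := boundedMeasurable_comp_toUnitDisc
  have hg' : g ∈ Algebra.adjoin ℂ ({unitDiscCoord} ∪ star {unitDiscCoord} : Set (UnitDisc →ᵇ ℂ)) := hg
  clear hg
  induction hg' using Algebra.adjoin_induction with
  | mem g hg =>
    rcases hg with hg | hg
    · rw [mem_singleton_iff] at hg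
      subst hg
      exact coord
    · rw [Set.star_singleton, mem_singleton_iff] at hg
      subst hg
      convert coord_conj using 1
      ext x
      change (starRingEnd ℂ) (cauchyKernel (-Complex.I) x) = _
      rw [conj_cauchyKernel]
      simp
  | algebraMap c => exact const c
  | add f g _ _ hf hg => exact add _ _ (hb f) (hb g) hf hg
  | mul f g _ _ hf hg => exact mul _ _ (hb f) (hb g) hf hg

end Disc

/-! ### Uniqueness of the spectral measure -/

section Uniqueness

variable {E : Type*} [NormedAddCommGroup E] [InnerProductSpace ℂ E] [CompleteSpace E]
variable {T : E →ₗ.[ℂ] E}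

theorem IsSpectralMeasureOf.unique (hT : IsSelfAdjoint T) {P Q : ProjectionValuedMeasure E}
    (hP : IsSpectralMeasureOf T P) (hQ : IsSpectralMeasureOf T Q) : P = Q := by
  refine ProjectionValuedMeasure.ext_of_measureAt fun u => ?_
  have hk : ∀ z : ℂ, z.im ≠ 0 → P.integral (cauchyKernel z) = Q.integral (cauchyKernel z) :=
    fun z hz => (hP.isResolventAt hz).unique hT hz (hQ.isResolventAt hz)
  rw [← map_ofUnitDisc_map_toUnitDisc (P.measureAt u),
    ← map_ofUnitDisc_map_toUnitDisc (Q.measureAt u)]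
  congr 1
  refine ext_of_forall_mem_subalgebra_integral_eq_of_pseudoEMetric_complete_countable
    separatesPoints_unitDiscPolynomials fun g hg => ?_
  have h : P.integral (fun x => g (toUnitDisc x)) = Q.integral fun x => g (toUnitDisc x) := by
    refine unitDiscPolynomials_induction (p := fun f => P.integral f = Q.integral f)
      (hk _ (by simp)) (fun c => ?_) (fun f g hf hg ihf ihg => ?_) (fun f g hf hg ihf ihg => ?_)
      (hk _ (by simp)) hg
    · rw [P.integral_const, Q.integral_const]
    · rw [P.integral_add hf hg, Q.integral_add hf hg, ihf, ihg]
    · rw [P.integral_mul hf hg, Q.integral_mul hf hg, ihf, ihg]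
  have hb := boundedMeasurable_comp_toUnitDisc g
  rw [integral_map_toUnitDisc, integral_map_toUnitDisc, ← P.inner_integral hb,
    ← Q.inner_integral hb, h]

theorem IsSelfAdjoint.existsUnique_isSpectralMeasureOf (hT : IsSelfAdjoint T) :
    ∃! P : ProjectionValuedMeasure E, IsSpectralMeasureOf T P := by
  obtain ⟨P, hP⟩ := hT.exists_isSpectralMeasureOf
  exact ⟨P, hP, fun Q hQ => hQ.unique hT hP⟩

theorem IsSelfAdjoint.exists_spectralMeasureAt_eq (hT : IsSelfAdjoint T) :
    ∃ P : ProjectionValuedMeasure E, IsSpectralMeasureOf T P ∧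
      ∀ u, spectralMeasureAt T u = P.measureAt u := by
  have h := hT.exists_isSpectralMeasureOf
  exact ⟨h.choose, h.choose_spec, fun u => by rw [spectralMeasureAt, dif_pos h]⟩

end Uniqueness

/-! ### Self-adjointness of the Anderson operator -/

section Lattice

variable {d : ℕ}

/-- The translation `(S_a u)(n) = u (n + a)`. -/
noncomputable def LatticeL2.shift (a : Fin d → ℤ) (u : LatticeL2 d) : LatticeL2 d :=
  ⟨fun n => u (n + a), LatticeL2.memℓp_shift u a⟩

theorem LatticeL2.inner_shift (a : Fin d → ℤ) (u v : LatticeL2 d) :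
    inner ℂ (LatticeL2.shift a u) v = inner ℂ u (LatticeL2.shift (-a) v) := by
  rw [lp.inner_eq_tsum, lp.inner_eq_tsum, ← (Equiv.addRight a).tsum_eq
    fun n => inner ℂ (u n) (LatticeL2.shift (-a) v n)]
  refine tsum_congr fun n => ?_
  change inner ℂ (u (n + a)) (v n) = inner ℂ (u (n + a)) (v (n + a + -a))
  rw [add_neg_cancel_right]

theorem latticeLaplacian_eq_sum_shift (u : LatticeL2 d) :
    latticeLaplacian d u = ∑ k : Fin d, (LatticeL2.shift (Pi.single k 1) u
      + LatticeL2.shift (-Pi.single k 1) u) := by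
  ext n
  rw [lp.coeFn_sum, Finset.sum_apply]
  rfl

theorem latticeLaplacian_isSymmetric (d : ℕ) : (latticeLaplacian d).IsSymmetric := by
  intro u v
  rw [latticeLaplacian_eq_sum_shift, latticeLaplacian_eq_sum_shift, sum_inner, inner_sum]
  refine Finset.sum_congr rfl fun k _ => ?_
  rw [inner_add_left, inner_add_right, LatticeL2.inner_shift, LatticeL2.inner_shift, neg_neg,
    add_comm]

/-- Hellinger–Toeplitz: a symmetric operator defined everywhere is bounded. -/
theorem continuous_latticeLaplacian (d : ℕ) : Continuous (latticeLaplacian d) :=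
  (latticeLaplacian_isSymmetric d).continuous

theorem mem_andersonOperator_domain {w : (Fin d → ℤ) → ℝ} {u : LatticeL2 d} :
    u ∈ (andersonOperator w).domain ↔ Memℓp (fun n => (w n : ℂ) * u n) 2 := Iff.rfl

theorem andersonOperator_apply {w : (Fin d → ℤ) → ℝ} {u v : LatticeL2 d}
    (hv : ∀ n, v n = (w n : ℂ) * u n) :
    ∃ hu : u ∈ (andersonOperator w).domain,
      andersonOperator w ⟨u, hu⟩ = latticeLaplacian d u + v := by
  have e : (fun n => (w n : ℂ) * u n) = v := funext fun n => (hv n).symm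
  refine ⟨mem_andersonOperator_domain.2 (e ▸ lp.memℓp v), ?_⟩
  change latticeLaplacian d u + _ = _
  congr 1
  ext n
  exact (hv n).symm

/-- The restriction of a vector to a finite set of sites. -/
noncomputable def LatticeL2.truncate (s : Finset (Fin d → ℤ)) (u : (Fin d → ℤ) → ℂ) :
    LatticeL2 d := ∑ i ∈ s, lp.single 2 i (u i)

theorem LatticeL2.truncate_apply (s : Finset (Fin d → ℤ)) (u : (Fin d → ℤ) → ℂ) (n : Fin d → ℤ) :
    LatticeL2.truncate s u n = if n ∈ s then u n else 0 := by
  classical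
  rw [LatticeL2.truncate, lp.coeFn_sum, Finset.sum_apply]
  simp [lp.single_apply, Pi.single_apply]

theorem LatticeL2.tendsto_truncate (u : LatticeL2 d) :
    Tendsto (fun s => LatticeL2.truncate s u) atTop (𝓝 u) :=
  lp.hasSum_single (by simp) u

theorem andersonOperator_truncate (w : (Fin d → ℤ) → ℝ) (s : Finset (Fin d → ℤ))
    (u : (Fin d → ℤ) → ℂ) :
    ∃ hu : LatticeL2.truncate s u ∈ (andersonOperator w).domain,
      andersonOperator w ⟨_, hu⟩ = latticeLaplacian d (LatticeL2.truncate s u)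
        + LatticeL2.truncate s fun n => (w n : ℂ) * u n :=
  andersonOperator_apply fun n => by
    rw [LatticeL2.truncate_apply, LatticeL2.truncate_apply]; split_ifs <;> simp

theorem dense_andersonOperator_domain (w : (Fin d → ℤ) → ℝ) :
    Dense ((andersonOperator w).domain : Set (LatticeL2 d)) := fun u =>
  mem_closure_of_tendsto (LatticeL2.tendsto_truncate u)
    (Eventually.of_forall fun s => (andersonOperator_truncate w s u).1)

theorem andersonOperator_isFormalAdjoint (w : (Fin d → ℤ) → ℝ) :
    (andersonOperator w).IsFormalAdjoint (andersonOperator w) := by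
  intro x y
  have h : ∀ u : (andersonOperator w).domain, ∃ v : LatticeL2 d, (∀ n, v n = (w n : ℂ) *
      (u : LatticeL2 d) n) ∧ andersonOperator w u = latticeLaplacian d u + v := fun u =>
    ⟨⟨_, mem_andersonOperator_domain.1 u.2⟩, fun n => rfl, rfl⟩
  obtain ⟨vx, hx, ex⟩ := h x
  obtain ⟨vy, hy, ey⟩ := h y
  rw [ex, ey, inner_add_left, inner_add_right, latticeLaplacian_isSymmetric d]
  congr 1
  rw [lp.inner_eq_tsum, lp.inner_eq_tsum]
  refine tsum_congr fun n => ?_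
  rw [hx, hy]
  simp only [RCLike.inner_apply, map_mul, Complex.conj_ofReal]
  ring

/-- The operator `Δ + w` is self-adjoint. -/
theorem isSelfAdjoint_andersonOperator (w : (Fin d → ℤ) → ℝ) :
    IsSelfAdjoint (andersonOperator w) := by
  have hd := dense_andersonOperator_domain w
  rw [LinearPMap.isSelfAdjoint_def]
  refine (LinearPMap.eq_of_le_of_domain_eq
    ((andersonOperator_isFormalAdjoint w).le_adjoint hd) ?_).symm
  refine le_antisymm ((andersonOperator_isFormalAdjoint w).le_adjoint hd).1 fun y hy => ?_
  set v := (andersonOperator w).adjoint ⟨y, hy⟩ with hv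
  have hform : ∀ x : (andersonOperator w).domain, inner ℂ v (x : LatticeL2 d)
      = inner ℂ y (andersonOperator w x) := fun x =>
    LinearPMap.adjoint_isFormalAdjoint hd ⟨y, hy⟩ x
  -- Testing the adjoint relation on `δ_n` identifies `w y` with `v - Δ y`, which is in `ℓ²`; this
  -- is membership in the maximal domain.
  have hcoord : ∀ n, (v - latticeLaplacian d y : LatticeL2 d) n = (w n : ℂ) * y n := by
    intro n
    obtain ⟨h1, h2⟩ := andersonOperator_apply (w := w) (u := lp.single 2 n (1 : ℂ))
      (v := lp.single 2 n ((w n : ℂ))) (fun m => by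
        rcases eq_or_ne m n with rfl | h
        · simp
        · simp [lp.single_apply, h])
    have h3 := hform ⟨_, h1⟩
    rw [h2, inner_add_right, ← latticeLaplacian_isSymmetric d] at h3
    simp only [lp.inner_single_right, RCLike.inner_apply, one_mul] at h3
    have h4 := congrArg (starRingEnd ℂ) h3
    simp only [map_add, map_mul, Complex.conj_conj, Complex.conj_ofReal] at h4
    rw [lp.coeFn_sub, Pi.sub_apply, h4]
    ring
  exact (andersonOperator_apply hcoord).1

/-! ### Resolvent and Green function in terms of the potential -/

/-- The resolvent of `Δ + w`. -/
noncomputable def andersonResolvent (z : ℂ) (w : (Fin d → ℤ) → ℝ) :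
    LatticeL2 d →L[ℂ] LatticeL2 d := by
  classical exact if hz : z.im ≠ 0 then
    ((isSelfAdjoint_andersonOperator w).exists_isResolventAt hz).choose else 0

theorem isResolventAt_andersonResolvent {z : ℂ} (hz : z.im ≠ 0) (w : (Fin d → ℤ) → ℝ) :
    IsResolventAt (andersonOperator w) z (andersonResolvent z w) := by
  rw [andersonResolvent, dif_pos hz]
  exact ((isSelfAdjoint_andersonOperator w).exists_isResolventAt hz).choose_spec

theorem IsResolventAt.norm_apply_le {E : Type*} [NormedAddCommGroup E] [InnerProductSpace ℂ E]
    [CompleteSpace E] {T : E →ₗ.[ℂ] E} (hT : IsSelfAdjoint T) {z : ℂ} (hz : z.im ≠ 0)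
    {R : E →L[ℂ] E} (hR : IsResolventAt T z R) (v : E) : ‖R v‖ ≤ |z.im|⁻¹ * ‖v‖ := by
  obtain ⟨h, e⟩ := hR v
  have h1 := hT.im_mul_norm_le z ⟨R v, h⟩
  rw [e, add_sub_cancel_right] at h1
  rw [inv_mul_eq_div, le_div_iff₀' (abs_pos.2 hz)]
  exact h1

/-- The resolvent of `Δ + w` is strongly continuous in the potential `w`, for pointwise
convergence of potentials. -/
theorem continuous_andersonResolvent_apply {z : ℂ} (hz : z.im ≠ 0) (v : LatticeL2 d) :
    Continuous fun w : (Fin d → ℤ) → ℝ => andersonResolvent z w v := by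
  rw [continuous_iff_continuousAt]
  intro w
  have h0 : 0 < |z.im| := abs_pos.2 hz
  have hres := isResolventAt_andersonResolvent (d := d) hz
  obtain ⟨hu, he⟩ := hres w v
  set u := andersonResolvent z w v with hudef
  let wu : LatticeL2 d := ⟨_, mem_andersonOperator_domain.1 hu⟩
  have he' : v = latticeLaplacian d u + wu - z • u := by
    rw [eq_sub_iff_add_eq, ← he]; rfl
  -- The domain varies with the potential, but finitely supported vectors lie in all of them. Here
  -- `vs s = (Δ + w - z) (t s)`, and `Δ + w' - z` maps `t s` to `vs s` minus a correction supported
  -- in `s`; resolvent norms are at most `|Im z|⁻¹` for every potential.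
  let t : Finset (Fin d → ℤ) → LatticeL2 d := fun s => LatticeL2.truncate s u
  let vs : Finset (Fin d → ℤ) → LatticeL2 d := fun s =>
    latticeLaplacian d (t s) + LatticeL2.truncate s (fun n => (w n : ℂ) * u n) - z • t s
  have hvs : Tendsto vs atTop (𝓝 v) := by
    have h1 : Tendsto t atTop (𝓝 u) := LatticeL2.tendsto_truncate u
    have h2 := ((continuous_latticeLaplacian d).tendsto u).comp h1
    have h3 : Tendsto (fun s => LatticeL2.truncate s fun n => (w n : ℂ) * u n) atTop (𝓝 wu) :=
      LatticeL2.tendsto_truncate wu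
    have h4 := (h2.add h3).sub (h1.const_smul z)
    rwa [← he'] at h4
  have hbound : ∀ s w', ‖andersonResolvent z w' v - u‖ ≤ |z.im|⁻¹ * ‖v - vs s‖
      + |z.im|⁻¹ * ‖LatticeL2.truncate s fun n => ((w n : ℂ) - w' n) * u n‖ + ‖t s - u‖ := by
    intro s w'
    obtain ⟨hm, hA⟩ := andersonOperator_truncate w' s u
    have htr : LatticeL2.truncate s (fun n => ((w n : ℂ) - w' n) * u n)
        = LatticeL2.truncate s (fun n => (w n : ℂ) * u n)
          - LatticeL2.truncate s fun n => (w' n : ℂ) * u n := by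
      ext n
      rw [lp.coeFn_sub, Pi.sub_apply, LatticeL2.truncate_apply, LatticeL2.truncate_apply,
        LatticeL2.truncate_apply]
      split_ifs <;> ring
    have hR := (hres w').apply_eq (isSelfAdjoint_andersonOperator w') hz
      (v := vs s - LatticeL2.truncate s fun n => ((w n : ℂ) - w' n) * u n) hm (by
        rw [hA, htr]; simp only [vs, t]; abel)
    have hsplit : andersonResolvent z w' v - u = andersonResolvent z w' (v - vs s)
        + andersonResolvent z w' (LatticeL2.truncate s fun n => ((w n : ℂ) - w' n) * u n)
        + (t s - u) := by
      have hlin : ∀ a b c : LatticeL2 d, andersonResolvent z w' a = andersonResolvent z w' (a - b)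
          + andersonResolvent z w' c + andersonResolvent z w' (b - c) := fun a b c => by
        rw [← map_add, ← map_add]; congr 1; abel
      rw [hlin v (vs s) (LatticeL2.truncate s fun n => ((w n : ℂ) - w' n) * u n), hR]
      exact add_sub_assoc _ (t s) u
    rw [hsplit]
    refine (norm_add_le _ _).trans (add_le_add_left ((norm_add_le _ _).trans (add_le_add ?_ ?_)) _)
    · exact (hres w').norm_apply_le (isSelfAdjoint_andersonOperator w') hz _
    · exact (hres w').norm_apply_le (isSelfAdjoint_andersonOperator w') hz _
  rw [ContinuousAt, ← hudef, Metric.tendsto_nhds]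
  intro ε hε
  have hs : Tendsto (fun s => |z.im|⁻¹ * ‖v - vs s‖ + ‖t s - u‖) atTop (𝓝 0) := by
    have h1 : Tendsto t atTop (𝓝 u) := LatticeL2.tendsto_truncate u
    have h2 := ((tendsto_const_nhds (x := v)).sub hvs).norm.const_mul (|z.im|⁻¹)
    have h3 := h2.add ((h1.sub (tendsto_const_nhds (x := u))).norm)
    simpa using h3
  obtain ⟨s, hs⟩ := ((tendsto_order.1 hs).2 (ε / 2) (by positivity)).exists
  -- With `s` fixed, only finitely many coordinates of `w'` matter, so pointwise convergence
  -- suffices.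
  have hw : Tendsto (fun w' : (Fin d → ℤ) → ℝ =>
      |z.im|⁻¹ * ‖LatticeL2.truncate s fun n => ((w n : ℂ) - w' n) * u n‖) (𝓝 w) (𝓝 0) := by
    have hc : Continuous fun w' : (Fin d → ℤ) → ℝ =>
        |z.im|⁻¹ * ‖LatticeL2.truncate s fun n => ((w n : ℂ) - w' n) * u n‖ := by
      unfold LatticeL2.truncate
      refine continuous_const.mul (continuous_norm.comp (continuous_finsetSum _ fun i _ => ?_))
      exact (lp.isometry_single (E := fun _ : Fin d → ℤ => ℂ) (p := 2) i).continuous.comp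
        (by fun_prop)
    have h := hc.tendsto w
    have e : (LatticeL2.truncate s fun n => ((w n : ℂ) - w n) * u n) = 0 := by
      ext n; simp [LatticeL2.truncate_apply]
    rw [e] at h
    simpa using h
  filter_upwards [(tendsto_order.1 hw).2 (ε / 2) (by positivity)] with w' hw'
  rw [dist_eq_norm]
  have := hbound s w'
  linarith

/-- The matrix element `⟨δ_0, (Δ + w - z)⁻¹ δ_0⟩`. -/
noncomputable def greenFunction (z : ℂ) (w : (Fin d → ℤ) → ℝ) : ℂ :=
  andersonResolvent z w (latticeDelta 0) 0

theorem inner_latticeDelta (u : LatticeL2 d) : inner ℂ (latticeDelta 0) u = u 0 := by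
  rw [latticeDelta, lp.inner_single_left]
  simp

theorem norm_latticeDelta (n : Fin d → ℤ) : ‖latticeDelta n‖ = 1 := by
  rw [latticeDelta, lp.norm_single (by simp)]; simp

theorem continuous_greenFunction {z : ℂ} (hz : z.im ≠ 0) :
    Continuous (greenFunction (d := d) z) := by
  have h : greenFunction (d := d) z
      = fun w => inner ℂ (latticeDelta 0) (andersonResolvent z w (latticeDelta 0)) :=
    funext fun w => (inner_latticeDelta _).symm
  rw [h]
  exact continuous_const.inner (continuous_andersonResolvent_apply hz _)

/-- For `φ = (H - z)⁻¹ δ_0`, reality of `⟨φ, H φ⟩` gives `Im φ(0) = Im z ‖φ‖²`, and `‖φ‖ ≥ |φ(0)|`.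
Equivalently, `Im(-1/g) ≥ Im z` for a nonzero Green function `g`. -/
theorem im_mul_norm_sq_greenFunction_le {z : ℂ} (hz : 0 < z.im) (w : (Fin d → ℤ) → ℝ) :
    z.im * ‖greenFunction z w‖ ^ 2 ≤ (greenFunction z w).im := by
  obtain ⟨hm, he⟩ := isResolventAt_andersonResolvent hz.ne' w (latticeDelta 0)
  set φ := andersonResolvent z w (latticeDelta 0) with hφ
  have hg : greenFunction z w = φ 0 := rfl
  have h1 : (inner ℂ φ (andersonOperator w ⟨φ, hm⟩)).im = 0 := by
    rw [← Complex.conj_eq_iff_im, inner_conj_symm,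
      (isSelfAdjoint_andersonOperator w).inner_apply_left ⟨φ, hm⟩ ⟨φ, hm⟩]
  rw [he, inner_add_right, inner_smul_right, ← inner_conj_symm, inner_latticeDelta,
    inner_self_eq_norm_sq_to_K] at h1
  have h2 : (φ 0).im = z.im * ‖φ‖ ^ 2 := by
    simp [← Complex.ofReal_pow] at h1
    linarith
  rw [hg, h2]
  have h3 : ‖φ 0‖ ≤ ‖φ‖ := lp.norm_apply_le_norm (by simp) φ 0
  gcongr

/-- Dependence of the Green function on the potential at the origin. -/
theorem greenFunction_mul_one_add {z : ℂ} (hz : z.im ≠ 0) (w w' : (Fin d → ℤ) → ℝ)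
    (h0 : w' 0 = 0) (h : ∀ n, n ≠ 0 → w n = w' n) :
    greenFunction z w * (1 + w 0 * greenFunction z w') = greenFunction z w' := by
  obtain ⟨hm, he⟩ := isResolventAt_andersonResolvent hz w' (latticeDelta 0)
  set φ := andersonResolvent z w' (latticeDelta 0) with hφ
  have hg : greenFunction z w' = φ 0 := rfl
  let wφ : LatticeL2 d := ⟨_, mem_andersonOperator_domain.1 hm⟩
  have hw : ∀ n, wφ n = (w' n : ℂ) * φ n := fun n => rfl
  -- The two operators differ by a multiple of the projection onto `δ_0`, so `(Δ + w - z) φ = (1 +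
  -- w(0) φ(0)) δ_0`.
  obtain ⟨hm', he'⟩ := andersonOperator_apply (w := w) (u := φ)
    (v := wφ + ((w 0 : ℂ) * φ 0) • latticeDelta 0) (fun n => by
      rw [lp.coeFn_add, Pi.add_apply, lp.coeFn_smul, Pi.smul_apply, hw, latticeDelta,
        lp.single_apply]
      rcases eq_or_ne n 0 with rfl | hn
      · simp [h0]
      · simp [hn, h n hn])
  have hH : latticeLaplacian d φ + wφ = latticeDelta 0 + z • φ := he
  have hR := (isResolventAt_andersonResolvent hz w).apply_eq (isSelfAdjoint_andersonOperator w) hz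
    (v := (1 + (w 0 : ℂ) * φ 0) • latticeDelta 0) hm' (by
      rw [he', ← add_assoc, hH]; module)
  rw [map_smul] at hR
  have h1 : (1 + (w 0 : ℂ) * φ 0) * greenFunction z w = φ 0 :=
    congrArg (fun f : LatticeL2 d => f 0) hR
  rw [hg, mul_comm]
  exact h1

end Lattice

/-! ### Measurable dependence of the spectral measure, and its Green function bounds -/

theorem MeasureTheory.ProbabilityMeasure.measurable_coe_of_continuous {X Y : Type*}
    [TopologicalSpace X] [MeasurableSpace X] [OpensMeasurableSpace X] [TopologicalSpace Y]
    [MeasurableSpace Y] [BorelSpace Y] [HasOuterApproxClosed Y] {κ : X → ProbabilityMeasure Y}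
    (h : Continuous κ) : Measurable fun x => (κ x : Measure Y) := by
  refine Measurable.measure_of_isPiSystem_of_isProbabilityMeasure
    (by rw [BorelSpace.measurable_eq (α := Y), borel_eq_generateFrom_isClosed])
    isPiSystem_isClosed fun F (hF : IsClosed F) => ?_
  -- The mass of a closed set is a limit of integrals of continuous functions, each weakly
  -- continuous in the measure.
  refine measurable_of_tendsto_metrizable (f := fun n x => ∫⁻ y, hF.apprSeq n y ∂(κ x : Measure Y))
    (fun n => ?_) (tendsto_pi_nhds.2 fun x => HasOuterApproxClosed.tendsto_lintegral_apprSeq hF _)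
  refine Continuous.measurable (continuous_iff_continuousAt.2 fun x => ?_)
  exact ProbabilityMeasure.tendsto_iff_forall_lintegral_tendsto.1 (h.tendsto x) _

/-- Uniform bounds make products of strongly continuous families strongly continuous, as needed for
polynomials in the resolvent. -/
theorem continuous_apply_of_bounded {X E : Type*} [TopologicalSpace X] [NormedAddCommGroup E]
    [NormedSpace ℂ E] {A : X → E →L[ℂ] E} {C : ℝ} (hC : ∀ x v, ‖A x v‖ ≤ C * ‖v‖)
    (hA : ∀ v, Continuous fun x => A x v) {y : X → E} (hy : Continuous y) :
    Continuous fun x => A x (y x) := by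
  rw [continuous_iff_continuousAt]
  intro x
  have h1 : Tendsto (fun x' => A x' (y x' - y x)) (𝓝 x) (𝓝 0) := by
    refine squeeze_zero_norm (fun x' => hC x' _) ?_
    have h := ((hy.tendsto x).sub (tendsto_const_nhds (x := y x))).norm.const_mul C
    simpa using h
  have h2 := h1.add ((hA (y x)).tendsto x)
  simpa [ContinuousAt] using h2

section AndersonSpectralMeasure

variable {d : ℕ}

theorem measurable_spectralMeasureAt_andersonOperator :
    Measurable fun w : (Fin d → ℤ) → ℝ =>
      spectralMeasureAt (andersonOperator w) (latticeDelta 0) := by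
  choose P hP hPeq using fun w : (Fin d → ℤ) → ℝ =>
    (isSelfAdjoint_andersonOperator w).exists_spectralMeasureAt_eq
  have hprob : ∀ w, IsProbabilityMeasure ((P w).measureAt (latticeDelta 0)) := fun w =>
    ⟨by rw [(P w).measureAt_univ, norm_latticeDelta]; simp⟩
  have hres : ∀ z : ℂ, z.im ≠ 0 → ∀ v, Continuous fun w => (P w).integral (cauchyKernel z) v := by
    intro z hz v
    have : ∀ w, (P w).integral (cauchyKernel z) = andersonResolvent z w := fun w =>
      ((hP w).isResolventAt hz).unique (isSelfAdjoint_andersonOperator w) hz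
        (isResolventAt_andersonResolvent hz w)
    simp_rw [this]
    exact continuous_andersonResolvent_apply hz v
  have hpoly : ∀ g ∈ unitDiscPolynomials, ∀ v,
      Continuous fun w => (P w).integral (fun x => g (toUnitDisc x)) v := by
    intro g hg
    refine unitDiscPolynomials_induction
      (p := fun f => ∀ v, Continuous fun w => (P w).integral f v) (hres _ (by simp))
      (fun c v => ?_) (fun f g hf hg ihf ihg v => ?_) (fun f g hf hg ihf ihg v => ?_)
      (hres _ (by simp)) hg
    · simp only [ProjectionValuedMeasure.integral_const]
      exact continuous_const
    · simp only [ProjectionValuedMeasure.integral_add _ hf hg, _root_.add_apply]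
      exact (ihf v).add (ihg v)
    · simp only [ProjectionValuedMeasure.integral_mul _ hf hg, mul_apply_eq_comp]
      obtain ⟨C, hC⟩ := hf.2
      exact continuous_apply_of_bounded (A := fun w => (P w).integral f)
        (fun w v => (P w).norm_integral_apply_le hf.1 hC v) ihf (ihg v)
  let κ : ((Fin d → ℤ) → ℝ) → ProbabilityMeasure UnitDisc := fun w =>
    ⟨((P w).measureAt (latticeDelta 0)).map toUnitDisc,
      Measure.isProbabilityMeasure_map measurable_toUnitDisc.aemeasurable⟩
  have hκ : Continuous κ := by
    rw [continuous_iff_continuousAt]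
    intro w
    refine ProbabilityMeasure.tendsto_of_tight_of_separatesPoints ℂ ?_
      separatesPoints_unitDiscPolynomials fun g hg => ?_
    · rw [isTightMeasureSet_iff_exists_isCompact_measure_compl_le]
      exact fun ε _ => ⟨univ, isCompact_univ, fun μ _ => by simp⟩
    · have h : ∀ w, ∫ y, g y ∂(κ w : Measure UnitDisc) = inner ℂ (latticeDelta 0)
          ((P w).integral (fun x => g (toUnitDisc x)) (latticeDelta 0)) := fun w => by
        rw [(P w).inner_integral (boundedMeasurable_comp_toUnitDisc g)]
        exact integral_map_toUnitDisc g _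
      simp only [h]
      exact (continuous_const.inner (hpoly g hg _)).tendsto w
  have h := (Measure.measurable_map _ measurable_ofUnitDisc).comp
    (ProbabilityMeasure.measurable_coe_of_continuous hκ)
  convert h using 2 with w
  rw [hPeq]
  exact (map_ofUnitDisc_map_toUnitDisc _).symm

theorem isProbabilityMeasure_spectralMeasureAt_andersonOperator (w : (Fin d → ℤ) → ℝ) :
    IsProbabilityMeasure (spectralMeasureAt (andersonOperator w) (latticeDelta 0)) := by
  obtain ⟨P, -, h⟩ := (isSelfAdjoint_andersonOperator w).exists_spectralMeasureAt_eq
  rw [h]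
  exact ⟨by rw [P.measureAt_univ, norm_latticeDelta]; simp⟩

theorem greenFunction_eq_integral {z : ℂ} (hz : z.im ≠ 0) (w : (Fin d → ℤ) → ℝ) :
    greenFunction z w
      = ∫ x, cauchyKernel z x ∂(spectralMeasureAt (andersonOperator w) (latticeDelta 0)) := by
  obtain ⟨P, hP, h⟩ := (isSelfAdjoint_andersonOperator w).exists_spectralMeasureAt_eq
  rw [h, ← P.inner_integral (boundedMeasurable_cauchyKernel hz),
    (hP.isResolventAt hz).unique (isSelfAdjoint_andersonOperator w) hz
      (isResolventAt_andersonResolvent hz w), inner_latticeDelta]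
  rfl

theorem spectralMeasureAt_Ioo_le (w : (Fin d → ℤ) → ℝ) (x : ℝ) {ε : ℝ} (hε : 0 < ε) :
    spectralMeasureAt (andersonOperator w) (latticeDelta 0) (Ioo (x - ε) (x + ε))
      ≤ ENNReal.ofReal (2 * ε * (greenFunction ⟨x, ε⟩ w).im) := by
  have hz : (⟨x, ε⟩ : ℂ).im ≠ 0 := hε.ne'
  have hprob := isProbabilityMeasure_spectralMeasureAt_andersonOperator w
  rw [greenFunction_eq_integral hz]
  set m := spectralMeasureAt (andersonOperator w) (latticeDelta 0)
  have hint := (boundedMeasurable_cauchyKernel hz).integrable m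
  have him : (∫ t, cauchyKernel ⟨x, ε⟩ t ∂m).im = ∫ t, (cauchyKernel ⟨x, ε⟩ t).im ∂m :=
    (integral_im hint).symm
  rw [him, ← ofReal_measureReal, ← MeasureTheory.integral_const_mul]
  refine ENNReal.ofReal_le_ofReal ?_
  rw [← integral_indicator_one measurableSet_Ioo]
  refine integral_mono_of_nonneg (ae_of_all _ fun t => indicator_nonneg (fun _ _ => zero_le_one) t)
    (hint.im.const_mul _) (ae_of_all _ fun t => ?_)
  change (Ioo (x - ε) (x + ε)).indicator 1 t ≤ 2 * ε * (cauchyKernel ⟨x, ε⟩ t).im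
  rw [im_cauchyKernel]
  change _ ≤ 2 * ε * (ε / ((t - x) ^ 2 + ε ^ 2))
  by_cases ht : t ∈ Ioo (x - ε) (x + ε)
  -- Here `(t - x)² < ε²`, so `2ε²/((t - x)² + ε²) ≥ 1`; this fixes the factor `2ε`.
  · rw [indicator_of_mem ht, Pi.one_apply, mul_div_assoc', le_div_iff₀ (by positivity)]
    nlinarith [ht.1, ht.2]
  · rw [indicator_of_notMem ht]
    positivity

/-- Averaging over the potential at the origin: the Green function is a Cauchy kernel in the
variable `w 0`, with a parameter at distance at least `z.im` from the real line. -/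
theorem exists_im_greenFunction_le {z : ℂ} (hz : 0 < z.im) (w' : (Fin d → ℤ) → ℝ) (h0 : w' 0 = 0) :
    ∃ a y : ℝ, z.im ≤ y ∧ ∀ w : (Fin d → ℤ) → ℝ, (∀ n, n ≠ 0 → w n = w' n) →
      (greenFunction z w).im ≤ y / ((w 0 - a) ^ 2 + y ^ 2) := by
  have hformula := fun w h => greenFunction_mul_one_add hz.ne' w w' h0 h
  have hH := im_mul_norm_sq_greenFunction_le hz w'
  set g := greenFunction z w'
  rcases eq_or_ne g 0 with hg | hg
  · refine ⟨0, z.im, le_rfl, fun w hw => ?_⟩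
    have h := hformula w hw
    rw [hg, mul_zero, add_zero, mul_one] at h
    rw [h, Complex.zero_im]
    positivity
  · have hg0 : 0 < ‖g‖ ^ 2 := by have := norm_pos_iff.2 hg; positivity
    have him : (-g⁻¹).im = g.im / ‖g‖ ^ 2 := by
      rw [Complex.neg_im, Complex.inv_im, Complex.normSq_eq_norm_sq]; ring
    have hy : z.im ≤ (-g⁻¹).im := by rw [him, le_div_iff₀ hg0]; exact hH
    -- Solving the rank-one relation gives `G = 1/(w(0) - c)` with `c = -1/g`; centre and width are
    -- its real and imaginary parts.
    refine ⟨(-g⁻¹).re, (-g⁻¹).im, hy, fun w hw => ?_⟩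
    rw [← im_cauchyKernel]
    refine le_of_eq (congrArg Complex.im ?_)
    have h := hformula w hw
    refine eq_inv_of_mul_eq_one_left (mul_right_cancel₀ hg ?_)
    have e : ((w 0 : ℂ) - -g⁻¹) * g = 1 + w 0 * g := by
      rw [sub_neg_eq_add, add_mul, inv_mul_cancel₀ hg, add_comm]
    rw [one_mul, mul_assoc, e, h]

end AndersonSpectralMeasure

/-! ### Poisson integrals of Hölder continuous measures -/

section Poisson

variable {α : ℝ} {μ : Measure ℝ}

/-- The dyadic decomposition needs intervals of every length; beyond half-length `1` the total mass
bound `1 ≤ s^α` takes over, whence the `+ 1` in the constant. -/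
theorem UniformlyHolderContinuous.exists_forall_measure_Ioo_le [IsProbabilityMeasure μ]
    (hα0 : 0 < α) (h : UniformlyHolderContinuous α μ) :
    ∃ K : ℝ≥0∞, K ≠ ∞ ∧ ∀ (a s : ℝ), 0 < s → μ (Ioo (a - s) (a + s)) ≤ K * ENNReal.ofReal (s ^ α) := by
  set C := ⨆ x : ℝ, ⨆ ε ∈ Set.Ioc (0 : ℝ) 1,
    μ (Set.Ioo (x - ε) (x + ε)) / ENNReal.ofReal ((2 * ε) ^ α) with hC
  have hCtop : C ≠ ∞ := ne_of_lt h
  refine ⟨C * ENNReal.ofReal (2 ^ α) + 1,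
    ENNReal.add_ne_top.2 ⟨ENNReal.mul_ne_top hCtop ENNReal.ofReal_ne_top, ENNReal.one_ne_top⟩,
    fun a s hs => ?_⟩
  rw [add_mul, one_mul]
  rcases le_or_gt s 1 with hs1 | hs1
  · refine le_trans ?_ le_self_add
    have h1 : μ (Ioo (a - s) (a + s)) / ENNReal.ofReal ((2 * s) ^ α) ≤ C :=
      le_iSup_of_le a (le_iSup₂_of_le s ⟨hs, hs1⟩ le_rfl)
    have h2 : 0 < (2 * s) ^ α := by positivity
    rw [ENNReal.div_le_iff (ENNReal.ofReal_pos.2 h2).ne' ENNReal.ofReal_ne_top,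
      Real.mul_rpow zero_le_two hs.le, ENNReal.ofReal_mul (by positivity), ← mul_assoc] at h1
    exact h1
  · refine le_trans prob_le_one (le_trans ?_ le_add_self)
    rw [← ENNReal.ofReal_one]
    exact ENNReal.ofReal_le_ofReal (Real.one_le_rpow hs1.le hα0.le)

/-- A dyadic bound of the Poisson kernel by indicators of intervals. -/
theorem poissonKernel_le_tsum (a : ℝ) {y : ℝ} (hy : 0 < y) (v : ℝ) :
    ENNReal.ofReal (y ^ 2 / ((v - a) ^ 2 + y ^ 2)) ≤ ∑' k : ℕ, ENNReal.ofReal (4 * (1 / 4) ^ k) *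
      (Ioo (a - 2 ^ k * y) (a + 2 ^ k * y)).indicator 1 v := by
  have hex : ∃ k : ℕ, |v - a| < 2 ^ k * y := by
    obtain ⟨k, hk⟩ := pow_unbounded_of_one_lt (|v - a| / y) (one_lt_two)
    exact ⟨k, (div_lt_iff₀ hy).1 hk⟩
  classical
  -- For the least such `k = j + 1`, minimality gives `(v - a)² ≥ 4^j y²`, so the kernel is at most
  -- `4^(-j) = 4 · 4^(-k)`. For `k = 0` it is at most `1`.
  set k := Nat.find hex with hk
  have hmem : v ∈ Ioo (a - 2 ^ k * y) (a + 2 ^ k * y) := by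
    have := abs_lt.1 (Nat.find_spec hex)
    constructor <;> linarith [this.1, this.2]
  refine le_trans ?_ (ENNReal.le_tsum k)
  rw [indicator_of_mem hmem, Pi.one_apply, mul_one]
  refine ENNReal.ofReal_le_ofReal ?_
  rw [div_le_iff₀ (by positivity)]
  rcases Nat.eq_zero_or_pos k with h0 | hpos
  · rw [h0]
    nlinarith [sq_nonneg (v - a), sq_nonneg y]
  · obtain ⟨j, hj⟩ := Nat.exists_eq_succ_of_ne_zero hpos.ne'
    have h1 : ¬ |v - a| < 2 ^ j * y := Nat.find_min hex (by rw [← hk, hj]; exact Nat.lt_succ_self j)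
    push Not at h1
    have h2 : (2 ^ j * y) ^ 2 ≤ (v - a) ^ 2 := by
      rw [← sq_abs (v - a)]
      gcongr
    have h3 : ((1 : ℝ) / 4) ^ j * (2 ^ j) ^ 2 = 1 := by
      rw [← pow_mul, mul_comm j 2, pow_mul, ← mul_pow]; norm_num
    rw [hj, Nat.succ_eq_add_one, pow_succ (1 / 4 : ℝ)]
    have h4 : y ^ 2 = ((1 : ℝ) / 4) ^ j * (2 ^ j * y) ^ 2 := by
      rw [mul_pow, ← mul_assoc, h3, one_mul]
    have h5 : ((1 : ℝ) / 4) ^ j * (2 ^ j * y) ^ 2 ≤ (1 / 4) ^ j * (v - a) ^ 2 := by gcongr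
    have h6 : 0 ≤ ((1 : ℝ) / 4) ^ j * y ^ 2 := by positivity
    nlinarith

/-- The Poisson integral of a Hölder continuous measure. -/
theorem lintegral_poissonKernel_le (hα1 : α ≤ 1) {K : ℝ≥0∞}
    (hK : ∀ (a s : ℝ), 0 < s → μ (Ioo (a - s) (a + s)) ≤ K * ENNReal.ofReal (s ^ α))
    (a : ℝ) {y : ℝ} (hy : 0 < y) :
    ∫⁻ v, ENNReal.ofReal (y ^ 2 / ((v - a) ^ 2 + y ^ 2)) ∂μ
      ≤ 8 * (K * ENNReal.ofReal (y ^ α)) := by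
  refine (lintegral_mono fun v => poissonKernel_le_tsum a hy v).trans ?_
  rw [lintegral_tsum fun k =>
    ((measurable_one.indicator measurableSet_Ioo).const_mul _).aemeasurable]
  -- As `α ≤ 1`, the growth `(2^k)^α ≤ 2^k` of the interval masses leaves the summable factor `4 ·
  -- 2^(-k)`, with total `8`.
  have hterm : ∀ k : ℕ, ∫⁻ v, ENNReal.ofReal (4 * (1 / 4) ^ k) *
      (Ioo (a - 2 ^ k * y) (a + 2 ^ k * y)).indicator 1 v ∂μ
        ≤ ENNReal.ofReal (4 * (1 / 2) ^ k) * (K * ENNReal.ofReal (y ^ α)) := by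
    intro k
    rw [lintegral_const_mul _ (measurable_one.indicator measurableSet_Ioo),
      lintegral_indicator_one measurableSet_Ioo]
    refine (mul_le_mul_right (hK a (2 ^ k * y) (by positivity)) _).trans ?_
    rw [mul_left_comm, mul_left_comm _ K, ← ENNReal.ofReal_mul (by positivity),
      ← ENNReal.ofReal_mul (by positivity)]
    refine mul_le_mul_right (ENNReal.ofReal_le_ofReal ?_) K
    rw [Real.mul_rpow (by positivity) hy.le]
    have h1 : ((2 : ℝ) ^ k) ^ α ≤ 2 ^ k := by
      conv_rhs => rw [← Real.rpow_one ((2 : ℝ) ^ k)]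
      exact Real.rpow_le_rpow_of_exponent_le (one_le_pow₀ one_le_two) hα1
    have h2 : ((1 : ℝ) / 4) ^ k * 2 ^ k = (1 / 2) ^ k := by rw [← mul_pow]; norm_num
    calc 4 * (1 / 4) ^ k * (((2 : ℝ) ^ k) ^ α * y ^ α)
        ≤ 4 * (1 / 4) ^ k * (2 ^ k * y ^ α) := by gcongr
      _ = 4 * (1 / 2) ^ k * y ^ α := by rw [← h2]; ring
  refine (ENNReal.tsum_le_tsum hterm).trans ?_
  rw [ENNReal.tsum_mul_right, ← ENNReal.ofReal_tsum_of_nonneg (fun k => by positivity)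
    (summable_geometric_two.mul_left 4), tsum_mul_left, tsum_geometric_two]
  norm_num

/-- The bound is free of `a` and `y`, which in the application depend on the frozen potential:
`(ε/y) y^α ≤ (ε/y)^α y^α = ε^α` since `ε/y ≤ 1` and `α ≤ 1`. -/
theorem lintegral_poissonKernel_le_of_le (hα1 : α ≤ 1) {K : ℝ≥0∞}
    (hK : ∀ (a s : ℝ), 0 < s → μ (Ioo (a - s) (a + s)) ≤ K * ENNReal.ofReal (s ^ α))
    (a : ℝ) {y ε : ℝ} (hε : 0 < ε) (hy : ε ≤ y) :
    ∫⁻ v, ENNReal.ofReal (2 * ε * (y / ((v - a) ^ 2 + y ^ 2))) ∂μ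
      ≤ 16 * K * ENNReal.ofReal (ε ^ α) := by
  have hy0 := hε.trans_le hy
  have h1 : ∀ v, ENNReal.ofReal (2 * ε * (y / ((v - a) ^ 2 + y ^ 2)))
      = ENNReal.ofReal (2 * (ε / y)) * ENNReal.ofReal (y ^ 2 / ((v - a) ^ 2 + y ^ 2)) := fun v => by
    rw [← ENNReal.ofReal_mul (by positivity)]
    congr 1
    field_simp
  simp_rw [h1]
  rw [lintegral_const_mul _ (by fun_prop)]
  refine (mul_le_mul_right (lintegral_poissonKernel_le hα1 hK a hy0) _).trans ?_
  have h2 : 2 * (ε / y) * y ^ α ≤ 2 * ε ^ α := by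
    have h3 : ε / y ≤ (ε / y) ^ α := by
      conv_lhs => rw [← Real.rpow_one (ε / y)]
      exact Real.rpow_le_rpow_of_exponent_ge (by positivity) ((div_le_one hy0).2 hy) hα1
    have h4 : (ε / y) ^ α * y ^ α = ε ^ α := by
      rw [← Real.mul_rpow (by positivity) hy0.le, div_mul_cancel₀ _ hy0.ne']
    have h5 : ε / y * y ^ α ≤ (ε / y) ^ α * y ^ α := by gcongr
    linarith
  calc ENNReal.ofReal (2 * (ε / y)) * (8 * (K * ENNReal.ofReal (y ^ α)))
      = 8 * K * ENNReal.ofReal (2 * (ε / y) * y ^ α) := by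
        rw [ENNReal.ofReal_mul (p := 2 * (ε / y)) (by positivity)]; ring
    _ ≤ 8 * K * ENNReal.ofReal (2 * ε ^ α) := by gcongr
    _ = 16 * K * ENNReal.ofReal (ε ^ α) := by
        rw [ENNReal.ofReal_mul zero_le_two, ENNReal.ofReal_ofNat]; ring

end Poisson

/-! ### Averaging over the potential at the origin -/

section Averaging

theorem ProbabilityTheory.iIndepFun.indepFun_update_zero {ι Ω : Type*} [MeasurableSpace Ω]
    [DecidableEq ι] {Pr : Measure Ω} {V : ι → Ω → ℝ} (hV : ∀ n, Measurable (V n))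
    (h : iIndepFun V Pr) (i : ι) :
    IndepFun (V i) (fun ω => Function.update (fun n => V n ω) i 0) Pr := by
  have h1 := indep_iSup_of_disjoint (fun n => (hV n).comap_le) h.iIndep
    (disjoint_compl_right (a := ({i} : Set ι)))
  rw [IndepFun_iff_Indep]
  refine indep_of_indep_of_le_left (indep_of_indep_of_le_right h1 ?_) ?_
  · refine Measurable.comap_le (@measurable_pi_lambda _ _ _ (_) _ _ fun n => ?_)
    rcases eq_or_ne n i with rfl | hn
    · simp
    · simp only [Function.update_of_ne hn]
      rw [measurable_iff_comap_le]
      exact le_iSup₂_of_le n hn le_rfl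
  · exact le_iSup₂_of_le i rfl le_rfl

/-- Independence splits the law of `V` into `μ` at the origin and the law of the other sites. The
inner integral over the origin is a Poisson integral, bounded uniformly in the other sites. -/
theorem lintegral_im_greenFunction_le {d : ℕ} {Ω : Type*} [MeasurableSpace Ω] {Pr : Measure Ω}
    [IsProbabilityMeasure Pr] {V : (Fin d → ℤ) → Ω → ℝ} (hV : ∀ n, Measurable (V n))
    (hindep : iIndepFun V Pr) {μ : Measure ℝ} [IsProbabilityMeasure μ] (hlaw : Pr.map (V 0) = μ)
    {α : ℝ} (hα1 : α ≤ 1) {K : ℝ≥0∞}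
    (hK : ∀ (a s : ℝ), 0 < s → μ (Ioo (a - s) (a + s)) ≤ K * ENNReal.ofReal (s ^ α))
    (x : ℝ) {ε : ℝ} (hε : 0 < ε) :
    ∫⁻ ω, ENNReal.ofReal (2 * ε * (greenFunction ⟨x, ε⟩ fun n => V n ω).im) ∂Pr
      ≤ 16 * K * ENNReal.ofReal (ε ^ α) := by
  let F : ((Fin d → ℤ) → ℝ) → ℝ≥0∞ := fun w =>
    ENNReal.ofReal (2 * ε * (greenFunction ⟨x, ε⟩ w).im)
  have hF : Continuous F := ENNReal.continuous_ofReal.comp (continuous_const.mul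
    (Complex.continuous_im.comp (continuous_greenFunction (z := ⟨x, ε⟩) hε.ne')))
  let V' : Ω → (Fin d → ℤ) → ℝ := fun ω => Function.update (fun n => V n ω) 0 0
  have hV' : Measurable V' := measurable_pi_iff.2 fun n => by
    rcases eq_or_ne n 0 with rfl | hn
    · simp [V']
    · simpa [V', Function.update_of_ne hn] using hV n
  have hpair := (hindep.indepFun_update_zero hV 0).map_prod_eq_prod_map_map
    (hV 0).aemeasurable hV'.aemeasurable
  rw [hlaw] at hpair
  have hprob : IsProbabilityMeasure (Pr.map V') := Measure.isProbabilityMeasure_map hV'.aemeasurable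
  have hG : Measurable fun p : ℝ × ((Fin d → ℤ) → ℝ) => F (Function.update p.2 0 p.1) :=
    (hF.comp (continuous_snd.update 0 continuous_fst)).measurable
  have hV'0 : ∀ᵐ w' ∂(Pr.map V'), w' 0 = 0 :=
    (ae_map_iff hV'.aemeasurable (measurableSet_eq_fun (measurable_pi_apply 0) measurable_const)).2
      (ae_of_all _ fun ω => by simp [V'])
  calc ∫⁻ ω, F (fun n => V n ω) ∂Pr
      = ∫⁻ p, F (Function.update p.2 0 p.1) ∂(Pr.map fun ω => (V 0 ω, V' ω)) := by
        rw [lintegral_map hG ((hV 0).prodMk hV')]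
        refine lintegral_congr fun ω => ?_
        simp [V']
    _ = ∫⁻ w', ∫⁻ v, F (Function.update w' 0 v) ∂μ ∂(Pr.map V') := by
        rw [hpair, lintegral_prod_symm' _ hG]
    _ ≤ ∫⁻ _, 16 * K * ENNReal.ofReal (ε ^ α) ∂(Pr.map V') := by
        refine lintegral_mono_ae ?_
        filter_upwards [hV'0] with w' hw'
        obtain ⟨a, y, hy, hle⟩ := exists_im_greenFunction_le (z := ⟨x, ε⟩) hε w' hw'
        refine le_trans (lintegral_mono fun v => ENNReal.ofReal_le_ofReal ?_)
          (lintegral_poissonKernel_le_of_le hα1 hK a hε hy)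
        have h := hle (Function.update w' 0 v) fun n hn => Function.update_of_ne hn _ _
        rw [Function.update_self] at h
        gcongr
    _ = 16 * K * ENNReal.ofReal (ε ^ α) := by simp

end Averaging

/-- For i.i.d. `V n` with uniformly `α`-Hölder continuous law `μ`, the density of states of
`H^ω = Δ + V^ω` is uniformly `α`-Hölder continuous. The first four conjuncts say that the density
of states is well defined: the operators are self-adjoint, each has exactly one spectral measure,
the measure `⟨δ_0, E_{H^ω}(·) δ_0⟩` depends measurably on `ω`, and its mean is a probability
measure. -/
theorem corollary1 {d : ℕ} {Ω : Type*} [MeasurableSpace Ω] (Pr : Measure Ω) [IsProbabilityMeasure Pr]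
    (V : (Fin d → ℤ) → Ω → ℝ) (hV : ∀ n, Measurable (V n)) (hindep : iIndepFun V Pr)
    (μ : Measure ℝ) [IsProbabilityMeasure μ] (hlaw : ∀ n, Pr.map (V n) = μ)
    (α : ℝ) (hα0 : 0 < α) (hα1 : α ≤ 1) (hμ : UniformlyHolderContinuous α μ) :
    (∀ ω, IsSelfAdjoint (andersonOperator fun n => V n ω)) ∧
    (∀ ω, ∃! P : ProjectionValuedMeasure (LatticeL2 d),
      IsSpectralMeasureOf (andersonOperator fun n => V n ω) P) ∧
    (Measurable fun ω =>
      spectralMeasureAt (andersonOperator fun n => V n ω) (latticeDelta 0)) ∧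
    IsProbabilityMeasure (densityOfStates Pr V) ∧
    UniformlyHolderContinuous α (densityOfStates Pr V) := by
  have hmeas : Measurable fun ω =>
      spectralMeasureAt (andersonOperator fun n => V n ω) (latticeDelta 0) :=
    measurable_spectralMeasureAt_andersonOperator.comp (measurable_pi_iff.2 hV)
  refine ⟨fun ω => isSelfAdjoint_andersonOperator _, fun ω =>
    (isSelfAdjoint_andersonOperator _).existsUnique_isSpectralMeasureOf, hmeas, ⟨?_⟩, ?_⟩
  · rw [densityOfStates, Measure.bind_apply MeasurableSet.univ hmeas.aemeasurable]
    have := fun ω => isProbabilityMeasure_spectralMeasureAt_andersonOperator fun n => V n ω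
    simp
  · obtain ⟨K, hKtop, hK⟩ := hμ.exists_forall_measure_Ioo_le hα0
    refine lt_of_le_of_lt (b := 16 * K) (iSup_le fun x => iSup₂_le fun ε hε => ?_)
      (ENNReal.mul_lt_top (by simp) hKtop.lt_top)
    refine ENNReal.div_le_of_le_mul ?_
    rw [densityOfStates, Measure.bind_apply measurableSet_Ioo hmeas.aemeasurable]
    refine (lintegral_mono fun ω => spectralMeasureAt_Ioo_le _ x hε.1).trans ?_
    refine (lintegral_im_greenFunction_le hV hindep (hlaw 0) hα1 hK x hε.1).trans ?_
    have h0 := hε.1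
    -- The definition divides by `(2ε)^α`, which dominates `ε^α`.
    gcongr
    linarith
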